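/- Let $k\ge 1$ and let $X_k$ be the metric tree with a single vertex $O$ and $k$ prongs $[0,\infty)$ of infinite length, labelled by $\mathbb{Z}/k$, with path metric $d_{X_k}$. A $k$-planar end $P$ is a surface obtained from $k$ closed Euclidean upper half-planes $H_j$ $(j\in\mathbb{Z}/k)$ by gluing finitely many closed intervals of their boundary lines in pairs by orientation-compatible isometries $x\mapsto c-x$, in such a way that no boundary point is glued to itself (no cone points of angle $\pi$), that for each $j$ the positive boundary ray of $H_j$ is glued near infinity to the negative boundary ray of $H_{j+1}$, and that $P$ is conformally a punctured disk: there is a homeomorphism $\varphi:P\to\{0<|w|\le 1\}$, conformal in the interior, taking the unglued part of the boundary lines to $|w|=1$ and infinity to $0$. For a suitable $\theta\in\mathbb{R}$, $\varphi$ takes the $k$ boundary rays to arcs incident to $0$ at the asymptotic angles $\theta+2\pi j/k$; rotating $\varphi$ changes $\theta$. The collapsing map $c_P:P\to X_k$ maps $H_j$ to the $j$-th prong by $z\mapsto \operatorname{Im} z$. Let $\mathbb{D}^*=\{0<|w|<1\}$, and let $\mathscr{M}(k)$ be the set of all model maps $m=c_P\circ\varphi^{-1}:\mathbb{D}^*\to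 X_k$, over all $k$-planar ends $P$ and all such $\varphi$. If $m_1,m_2\in\mathscr{M}(k)$ are distinct, then the function $d(z)=d_{X_k}(m_1(z),m_2(z))$ is unbounded on $\mathbb{D}^*$. -/

import Mathlib

open Filter Topology

noncomputable section

/-! ### The tree with `k` infinite prongs -/

/-- The metric tree `X_k`: `k` copies of the ray `[0, ∞)` glued at their origins, realised as the
union of the non-negative coordinate axes of `ℝ^k`. The `ℓ¹` distance restricts on it to the path
metric of the tree, see `dist_prong_same` and `dist_prong_ne`. -/
abbrev ProngedTree (k : ℕ) [NeZero k] : Type :=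
  {x : PiLp 1 (fun _ : ZMod k => ℝ) // (∀ i, 0 ≤ x i) ∧ ∀ i j, i ≠ j → x i = 0 ∨ x j = 0}

/-- The point at distance `t` from the vertex on the prong with label `j`. -/
def prong {k : ℕ} [NeZero k] (j : ZMod k) (t : ℝ) (ht : 0 ≤ t) : ProngedTree k :=
  ⟨WithLp.toLp 1 (Pi.single j t), by
    constructor
    · intro i
      by_cases h : i = j
      · subst h; simpa using ht
      · simp [h]
    · intro i l hil
      by_cases h : i = j
      · right
        have : l ≠ j := fun h' => hil (h.trans h'.symm)
        simp [this]
      · left; simp [h]⟩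

theorem prong_zero {k : ℕ} [NeZero k] (i j : ZMod k) (t s : ℝ) (ht : 0 ≤ t) (hs : 0 ≤ s)
    (ht0 : t = 0) (hs0 : s = 0) : prong i t ht = prong j s hs := by
  subst ht0 hs0
  apply Subtype.ext
  simp [prong]

theorem dist_prong_same {k : ℕ} [NeZero k] (j : ZMod k) (t s : ℝ) (ht : 0 ≤ t) (hs : 0 ≤ s) :
    dist (prong j t ht) (prong j s hs) = |t - s| := by
  rw [Subtype.dist_eq, dist_eq_norm, PiLp.norm_eq_of_L1, Finset.sum_eq_single j]
  · simp [prong]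
  · intro i _ hi
    simp [prong, hi]
  · simp

theorem dist_prong_ne {k : ℕ} [NeZero k] (i j : ZMod k) (hij : i ≠ j) (t s : ℝ) (ht : 0 ≤ t)
    (hs : 0 ≤ s) : dist (prong i t ht) (prong j s hs) = t + s := by
  rw [Subtype.dist_eq, dist_eq_norm, PiLp.norm_eq_of_L1, ← Finset.add_sum_erase _ _
    (Finset.mem_univ i), Finset.sum_eq_single j]
  · simp [prong, hij, hij.symm, abs_of_nonneg ht, abs_of_nonneg hs]
  · intro l hl hlj
    have : l ≠ i := Finset.ne_of_mem_erase hl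
    simp [prong, this, hlj]
  · intro h
    simp [hij.symm] at h

/-! ### Planar ends -/

/-- The closed Euclidean upper half-plane. -/
abbrev ClosedHalfPlane : Type := {z : ℂ // 0 ≤ z.im}

/-- The nearest-point projection of `ℂ` to the closed upper half-plane; it is only ever used at
points that lie in the half-plane already, where it is the identity. -/
def toHalfPlane (z : ℂ) : ClosedHalfPlane := ⟨⟨z.re, max z.im 0⟩, le_max_right _ _⟩

/-- A gluing pattern for `k` closed upper half-planes, with the half-planes in cyclic order.
Finitely many closed intervals on the boundary lines (segments, rays or lines, not reduced to a
point) with disjoint interiors are matched in pairs, `I e` with `I (rev e)`, and each is glued to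
its mate by the isometry `x ↦ shift e - x`. (The boundary isometry reverses the direction, so that
the orientations of the half-planes agree.) Parts of the boundary lines that lie in no `I e`
remain unglued. -/
structure PlanarGluing (k : ℕ) where
  /-- the number of intervals -/
  n : ℕ
  /-- the half-plane on the boundary of which the interval lies -/
  side : Fin n → ZMod k
  /-- the interval -/
  I : Fin n → Set ℝ
  /-- the interval to which it is glued -/
  rev : Fin n → Fin n
  shift : Fin n → ℝ
  isClosed_I : ∀ e, IsClosed (I e)
  ordConnected_I : ∀ e, (I e).OrdConnected
  interior_I : ∀ e, (interior (I e)).Nonempty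
  disjoint_I : ∀ e e', e ≠ e' → side e = side e' → Disjoint (interior (I e)) (interior (I e'))
  rev_rev : ∀ e, rev (rev e) = e
  rev_ne : ∀ e, rev e ≠ e
  shift_rev : ∀ e, shift (rev e) = shift e
  I_rev : ∀ e, I (rev e) = (fun x => shift e - x) '' I e
  /-- There is no fold: no boundary point is glued to itself. A cone point of angle `π` is exactly
  a point at which two adjacent intervals of one boundary line are folded together. -/
  no_fold : ∀ e, side (rev e) = side e → ∀ x ∈ I e, shift e - x ≠ x
  /-- The half-planes are cyclically ordered around the puncture: the positive boundary ray of
  each is glued, near infinity, to the negative boundary ray of the next. -/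
  cyclic : ∀ j : ZMod k, ∃ e, side e = j ∧ side (rev e) = j + 1 ∧ ∃ T : ℝ, Set.Ici T ⊆ I e

namespace PlanarGluing

variable {k : ℕ} (G : PlanarGluing k)

/-- The elementary identifications: the point `z` of the boundary interval `I e` is glued to the
point `shift e - z` of the boundary interval `I (rev e)`. -/
def Glued (p q : ZMod k × ClosedHalfPlane) : Prop :=
  ∃ e, p.1 = G.side e ∧ q.1 = G.side (G.rev e) ∧ (p.2 : ℂ).im = 0 ∧ (p.2 : ℂ).re ∈ G.I e ∧
    (q.2 : ℂ) = (G.shift e : ℂ) - (p.2 : ℂ)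

/-- The equivalence relation generated by the identifications. -/
def setoid : Setoid (ZMod k × ClosedHalfPlane) := Relation.EqvGen.setoid G.Glued

/-- The glued surface, with the quotient topology. Here the `k` half-planes are `{j} × H`, with
`j : ZMod k`, which carries the discrete topology. -/
def Surface : Type := Quotient G.setoid

instance : TopologicalSpace G.Surface :=
  letI : TopologicalSpace (ZMod k) := ⊥
  inferInstanceAs (TopologicalSpace (Quotient G.setoid))

/-- The point of the surface given by a point `z` of the `j`-th half-plane. -/
def pt (j : ZMod k) (z : ClosedHalfPlane) : G.Surface := Quotient.mk G.setoid (j, z)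

/-- The boundary of the surface, formed by the unglued intervals and their endpoints. -/
def boundary : Set G.Surface :=
  {p | ∃ (j : ZMod k) (x : ℝ),
    x ∈ closure {y : ℝ | ∀ e, G.side e = j → y ∉ G.I e} ∧ p = G.pt j (toHalfPlane x)}

/-- The flat coordinate of the surface around the interior points of the edge obtained from `I e`:
on the upper side of the real axis it is the half-plane of `I e`, on the lower side that of
`I (rev e)`, turned by `z ↦ shift e - z`. -/
def edgeChart (e : Fin G.n) (z : ℂ) : G.Surface :=
  if 0 ≤ z.im then G.pt (G.side e) (toHalfPlane z)
  else G.pt (G.side (G.rev e)) (toHalfPlane ((G.shift e : ℂ) - z))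

/-- The collapsing map of the surface: the `j`-th half-plane is mapped to the `j`-th prong by
`z ↦ Im z`. -/
def collapse [NeZero k] : G.Surface → ProngedTree k :=
  Quotient.lift (fun p : ZMod k × ClosedHalfPlane => prong p.1 (p.2 : ℂ).im p.2.2) (by
    intro p q h
    change Relation.EqvGen G.Glued p q at h
    induction h with
    | rel p q h =>
      obtain ⟨e, -, -, him, -, hq⟩ := h
      refine prong_zero _ _ _ _ _ _ him ?_
      rw [hq]
      simp [him]
    | refl => rfl
    | symm _ _ _ ih => exact ih.symm
    | trans _ _ _ _ _ ih₁ ih₂ => exact ih₁.trans ih₂)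

end PlanarGluing

/-! ### Model maps -/

/-- The punctured unit disk. -/
abbrev PuncturedDisk : Type := {w : ℂ // w ≠ 0 ∧ ‖w‖ < 1}

/-- The punctured unit disk together with its boundary circle. -/
abbrev ClosedPuncturedDisk : Type := {w : ℂ // w ≠ 0 ∧ ‖w‖ ≤ 1}

/-- A conformal homeomorphism of the glued surface with the punctured disk (boundaries included)
that takes infinity to the puncture and the `k` rays incident to infinity to arcs incident to the
puncture at the angles `θ + 2 π j / k`. A planar end is a gluing pattern for which such a map
exists. -/
structure Uniformization {k : ℕ} (G : PlanarGluing k) (θ : ℝ) where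
  φ : G.Surface ≃ₜ ClosedPuncturedDisk
  norm_eq_one_iff : ∀ p, ‖(φ p : ℂ)‖ = 1 ↔ p ∈ G.boundary
  /-- conformal in the open half-planes -/
  holo_halfPlane : ∀ j : ZMod k,
    DifferentiableOn ℂ (fun z : ℂ => (φ (G.pt j (toHalfPlane z)) : ℂ)) {z : ℂ | 0 < z.im}
  /-- conformal across the open edges; only finitely many interior points remain (among them the
  cone points), and around these the conformal structure is the unique extension -/
  holo_edge : ∀ (e : Fin G.n) (x : ℝ), x ∈ interior (G.I e) →
    DifferentiableAt ℂ (fun z : ℂ => (φ (G.edgeChart e z) : ℂ)) (x : ℂ)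
  tendsto_puncture : ∀ j : ZMod k,
    Tendsto (fun z : ClosedHalfPlane => (φ (G.pt j z) : ℂ)) (cocompact ClosedHalfPlane) (𝓝 0)
  /-- the ray between the half-planes `j` and `j + 1` arrives at the angle `θ + 2 π j / k` -/
  tendsto_angle : ∀ j : ZMod k,
    Tendsto (fun t : ℝ => (φ (G.pt j (toHalfPlane t)) : ℂ) / (‖(φ (G.pt j (toHalfPlane t)) : ℂ)‖ : ℂ))
      atTop (𝓝 (Complex.exp (Complex.I * ((θ + 2 * Real.pi * (j.val : ℝ) / k : ℝ) : ℂ))))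

/-- The model map `c ∘ φ⁻¹` of a planar end with collapsing map `c` and uniformization `φ`. -/
def modelMap {k : ℕ} [NeZero k] {G : PlanarGluing k} {θ : ℝ} (u : Uniformization G θ) :
    PuncturedDisk → ProngedTree k :=
  fun w => G.collapse (u.φ.symm ⟨(w : ℂ), w.2.1, w.2.2.le⟩)

/-- The set of all model maps from the punctured disk to the `k`-pronged tree. All angles `θ` are
admitted, not only those in `[0, 2 π / k)`. -/
def modelMaps (k : ℕ) [NeZero k] : Set (PuncturedDisk → ProngedTree k) :=
  {m | ∃ (G : PlanarGluing k) (θ : ℝ) (u : Uniformization G θ), m = modelMap u}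

end

/-! Suppose the distance is bounded by `C`. Both maps send the unit circle to the vertex and a
bounded subharmonic function does not see the puncture, so the maximum principle would finish the
proof if the distance were subharmonic. It need not be: where a half-plane is glued to itself along
an edge, the collapsing map folds like `|Im z|` and is not harmonic into the tree.

The remedy is to unfold. Choose a continuous logarithm of the uniformization on each half-plane and
give every sheet of every half-plane its own prong; this amounts to passing to the universal cover
of the disk. The resulting distance `sheetDist` dominates the distance in the tree. Off finitely
many vertices it has touching harmonic minorants from below wherever it is positive
(`exists_minorant`), and this is all that the maximum principle `nonpos_of_harmonic_minorants`
needs.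

The geometric core is `IsLog.ne_of_fold`: the two sides of a self-glued edge lie on different
sheets. Otherwise the boundary segment between them becomes a closed curve in the logarithmic plane.
Take an innermost such segment. If an open edge meets it, the curve is simple and regular there, so
its winding number jumps across the curve; but points on either side escape to infinity along
vertical rays of open half-planes, so both winding numbers vanish. If no open edge meets it, the
segment is unglued up to finitely many points and maps to a vertical line, where a closed curve
cannot be injective.

Finally `sheetDist` must be bounded. At height at least `C + 1` the bound `C` forces equal prongs,
and connectedness lets the second family of logarithms be adjusted so that the sheets agree as well
(`exists_isLog_sameSheet`). Elsewhere both heights are bounded. -/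

noncomputable section

/-! ### Complex analysis in the plane -/

/-- A nonvanishing continuous function on a simply connected space has a continuous logarithm. -/
theorem exists_continuous_log {X : Type*} [TopologicalSpace X] [SimplyConnectedSpace X]
    [LocallyPathConnectedSpace X] (f : X → ℂ) (hf : Continuous f) (h0 : ∀ x, f x ≠ 0) :
    ∃ L : X → ℂ, Continuous L ∧ ∀ x, Complex.exp (L x) = f x := by
  obtain ⟨a⟩ : Nonempty X := inferInstance
  obtain ⟨F, ⟨-, hF⟩, -⟩ := Complex.isCoveringMapOn_exp.existsUnique_continuousMap_lifts
    (⟨f, hf⟩ : C(X, ℂ)) (a₀ := a) (e₀ := Complex.log (f a)) (Complex.exp_log (h0 a))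
    (fun x => h0 x)
  exact ⟨F, F.continuous, fun x => congrFun hF x⟩

/-- A small complex number with exponential `1` vanishes. -/
theorem eq_zero_of_exp_eq_one_of_norm_lt {z : ℂ} (h : Complex.exp z = 1) (hz : ‖z‖ < 1) :
    z = 0 := by
  obtain ⟨n, hn⟩ := Complex.exp_eq_one_iff.1 h
  have h1 : ‖z‖ = |(n : ℝ)| * (2 * Real.pi) := by
    rw [hn]; simp [abs_of_pos Real.pi_pos]
  have hπ := Real.pi_gt_three
  by_cases h0 : n = 0
  · simp [hn, h0]
  · have : (1 : ℝ) ≤ |(n : ℝ)| := by exact_mod_cast Int.one_le_abs h0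
    nlinarith

/-- A continuous function on a preconnected set with exponential `1` is constant. -/
theorem eq_of_exp_eq_one {X : Type*} [TopologicalSpace X] {s : Set X} (hs : IsPreconnected s)
    {f : X → ℂ} (hf : ContinuousOn f s) (h : ∀ x ∈ s, Complex.exp (f x) = 1) {x y : X}
    (hx : x ∈ s) (hy : y ∈ s) : f x = f y := by
  refine hs.constant_of_mapsTo (T := {z : ℂ | Complex.exp z = 1}) (f := f) ?_ hf h hx hy
  rw [isDiscrete_iff_forall_mem_exists_isOpen]
  intro z hz
  refine ⟨Metric.ball z 1, Metric.isOpen_ball, ?_⟩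
  ext w
  simp only [Set.mem_inter_iff, Metric.mem_ball, dist_eq_norm, Set.mem_ofPred_eq,
    Set.mem_singleton_iff] at hz ⊢
  constructor
  · rintro ⟨h1, h2⟩
    exact sub_eq_zero.1 (eq_zero_of_exp_eq_one_of_norm_lt (by rw [Complex.exp_sub, h2, hz]; simp) h1)
  · rintro rfl
    simpa using hz

/-- An injective holomorphic function on an open set has no critical points. -/
theorem deriv_ne_zero_of_injOn {U : Set ℂ} (hU : IsOpen U) {E : ℂ → ℂ}
    (hd : DifferentiableOn ℂ E U) (hi : Set.InjOn E U) {a : ℂ} (ha : a ∈ U) : deriv E a ≠ 0 := by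
  have han : ∀ z ∈ U, AnalyticAt ℂ E z := fun z hz => hd.analyticAt (hU.mem_nhds hz)
  have hnc : ∀ z ∈ U, ¬ ∀ᶠ w in 𝓝 z, E w = E z := by
    intro z hz h
    have h1 : ∀ᶠ w in 𝓝 z, w = z := by
      filter_upwards [h, hU.mem_nhds hz] with w hw hwU using hi hwU hz hw
    have h2 : ∀ᶠ w in 𝓝[≠] z, w = z := h1.filter_mono nhdsWithin_le_nhds
    obtain ⟨w, hw, hw'⟩ := (h2.and self_mem_nhdsWithin).exists
    exact hw' hw
  have hopen : ∀ z ∈ U, 𝓝 (E z) ≤ map E (𝓝 z) := fun z hz =>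
    ((han z hz).eventually_constant_or_nhds_le_map_nhds).resolve_left (hnc z hz)
  -- The inverse is continuous by the open mapping theorem. It is holomorphic off the critical
  -- values, which are isolated, hence everywhere by removability; the chain rule then excludes a
  -- zero derivative.
  set ψ := Function.invFunOn E U with hψ
  have hleft : ∀ z ∈ U, ψ (E z) = z := fun z hz => hi.leftInvOn_invFunOn hz
  have hEU : ∀ z ∈ U, ∀ᶠ w in 𝓝 (E z), E (ψ w) = w ∧ ψ w ∈ U := by
    intro z hz
    have : E '' U ∈ 𝓝 (E z) := hopen z hz (image_mem_map (hU.mem_nhds hz))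
    filter_upwards [this]
    rintro _ ⟨x, hx, rfl⟩
    rw [hleft x hx]; exact ⟨rfl, hx⟩
  have hcont : ∀ z ∈ U, ContinuousAt ψ (E z) := by
    intro z hz
    rw [ContinuousAt, hleft z hz]
    intro N hN
    have : E '' (N ∩ U) ∈ 𝓝 (E z) :=
      hopen z hz (image_mem_map (inter_mem hN (hU.mem_nhds hz)))
    refine mem_map.2 ?_
    filter_upwards [this]
    rintro _ ⟨x, hx, rfl⟩
    rw [Set.mem_preimage, hleft x hx.2]; exact hx.1
  have hdiff : ∀ z ∈ U, deriv E z ≠ 0 → DifferentiableAt ℂ ψ (E z) := by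
    intro z hz h0
    refine (HasDerivAt.of_local_left_inverse (f := E) (f' := deriv E z) (hcont z hz) ?_ h0
      ((hEU z hz).mono fun w h => h.1)).differentiableAt
    rw [hleft z hz]
    exact (han z hz).differentiableAt.hasDerivAt
  have hcrit : ∀ᶠ z in 𝓝[≠] a, deriv E z ≠ 0 := by
    refine (han a ha).deriv.eventually_eq_zero_or_eventually_ne_zero.resolve_left fun h => ?_
    obtain ⟨r, hr, hb⟩ := Metric.eventually_nhds_iff_ball.1 (h.and (hU.mem_nhds ha))
    refine hnc a ha ?_
    filter_upwards [Metric.ball_mem_nhds a hr] with w hw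
    refine (convex_ball a r).is_const_of_fderivWithin_eq_zero (𝕜 := ℂ)
      (hd.mono fun z hz => (hb z hz).2) (fun z hz => ?_) hw (Metric.mem_ball_self hr)
    rw [fderivWithin_of_isOpen Metric.isOpen_ball hz]
    ext
    simpa using (hb z hz).1
  have hψa : AnalyticAt ℂ ψ (E a) := by
    refine Complex.analyticAt_of_differentiable_on_punctured_nhds_of_continuousAt ?_ (hcont a ha)
    rw [eventually_nhdsWithin_iff] at hcrit ⊢
    have h1 := (hcont a ha).tendsto
    rw [hleft a ha] at h1
    filter_upwards [h1.eventually hcrit, hEU a ha] with w h2 h3 h4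
    rw [← h3.1]
    refine hdiff _ h3.2 (h2 fun h5 => h4 ?_)
    rw [← h3.1, Set.mem_singleton_iff.1 h5]; rfl
  intro h0
  have h1 : HasDerivAt (ψ ∘ E) (deriv ψ (E a) * deriv E a) a :=
    hψa.differentiableAt.hasDerivAt.comp a (han a ha).differentiableAt.hasDerivAt
  have h2 : ψ ∘ E =ᶠ[𝓝 a] id := by
    filter_upwards [hU.mem_nhds ha] with z hz using hleft z hz
  have h3 := (h1.congr_of_eventuallyEq h2.symm).unique (hasDerivAt_id a)
  rw [h0, mul_zero] at h3
  exact zero_ne_one h3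

/-- An injective holomorphic function on an open set has holomorphic local inverses. -/
theorem exists_analytic_localInverse {U : Set ℂ} (hU : IsOpen U) {E : ℂ → ℂ}
    (hd : DifferentiableOn ℂ E U) (hi : Set.InjOn E U) {a : ℂ} (ha : a ∈ U) :
    ∃ ζ : ℂ → ℂ, AnalyticAt ℂ ζ (E a) ∧ ζ (E a) = a ∧ ∀ᶠ w in 𝓝 (E a), ζ w ∈ U ∧ E (ζ w) = w := by
  have han : AnalyticAt ℂ E a := hd.analyticAt (hU.mem_nhds ha)
  have h0 := deriv_ne_zero_of_injOn hU hd hi ha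
  have hA := han.analyticAt_localInverse h0
  have hz : han.hasStrictDerivAt.localInverse _ _ _ h0 (E a) = a :=
    HasStrictFDerivAt.localInverse_apply_image ..
  refine ⟨_, hA, hz, ?_⟩
  have h1 := hA.continuousAt.tendsto
  rw [hz] at h1
  filter_upwards [h1.eventually (hU.mem_nhds ha),
    HasStrictDerivAt.eventually_right_inverse han.hasStrictDerivAt h0] with w h2 h3
  exact ⟨h2, h3⟩

/-! ### The maximum principle on the punctured disk. -/

/-- If a harmonic function plus `δ ‖w - a‖ ^ 2` has a local maximum at `a`, then `δ ≤ 0`. -/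
theorem not_isLocalMax_re_add {G : ℂ → ℂ} {a : ℂ} (hG : AnalyticAt ℂ G a) {δ : ℝ} (hδ : 0 < δ)
    (h : ∀ᶠ w in 𝓝 a, (G w).re + δ * ‖w - a‖ ^ 2 ≤ (G a).re) : False := by
  -- Since `‖exp G‖ = exp (Re G)`, the maximum modulus principle makes `Re G` locally constant,
  -- leaving `δ ‖w - a‖ ^ 2 ≤ 0`.
  have hE : AnalyticAt ℂ (fun w => Complex.exp (G w)) a := hG.cexp
  have hmax : IsLocalMax (norm ∘ fun w => Complex.exp (G w)) a := by
    filter_upwards [h] with w hw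
    simp only [Function.comp, Complex.norm_exp, Real.exp_le_exp]
    nlinarith [sq_nonneg ‖w - a‖, mul_nonneg hδ.le (sq_nonneg ‖w - a‖)]
  have hc := Complex.eventually_eq_of_isLocalMax_norm
    (hE.eventually_analyticAt.mono fun z hz => hz.differentiableAt) hmax
  have h2 : ∀ᶠ w in 𝓝 a, w = a := by
    filter_upwards [h, hc] with w hw hw'
    have h3 : (G w).re = (G a).re := by
      have := congrArg norm hw'
      simpa [Complex.norm_exp] using this
    have h4 : ‖w - a‖ ^ 2 ≤ 0 := by
      by_contra h5
      push Not at h5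
      nlinarith [mul_pos hδ h5]
    have h5 : ‖w - a‖ = 0 := by
      have := sq_nonneg ‖w - a‖
      exact pow_eq_zero_iff (two_ne_zero) |>.1 (le_antisymm h4 this)
    exact sub_eq_zero.1 (norm_eq_zero.1 h5)
  have h3 : ∀ᶠ w in 𝓝[≠] a, w = a := h2.filter_mono nhdsWithin_le_nhds
  obtain ⟨w, hw, hw'⟩ := (h3.and self_mem_nhdsWithin).exists
  exact hw' hw

/-- A maximum principle on the punctured disk: a bounded continuous function which is non-positive
on the boundary circle, and which has, outside of finitely many points, harmonic local minorants
wherever it is positive, is non-positive. -/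
theorem nonpos_of_harmonic_minorants (f : ℂ → ℝ)
    (hf : ContinuousOn f {w : ℂ | w ≠ 0 ∧ ‖w‖ ≤ 1}) (B : ℝ)
    (hB : ∀ w : ℂ, w ≠ 0 → ‖w‖ ≤ 1 → f w ≤ B) (hbd : ∀ w : ℂ, ‖w‖ = 1 → f w ≤ 0)
    (V : Set ℂ) (hV : V.Finite)
    (hg : ∀ a : ℂ, a ≠ 0 → ‖a‖ < 1 → a ∉ V → 0 < f a →
      ∃ g : ℂ → ℂ, AnalyticAt ℂ g a ∧ (g a).re = f a ∧ ∀ᶠ w in 𝓝 a, (g w).re ≤ f w) :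
    ∀ w : ℂ, w ≠ 0 → ‖w‖ ≤ 1 → f w ≤ 0 := by
  intro b' hb'0 hb'1
  by_contra! hb'
  have hb'2 : ‖b'‖ < 1 := lt_of_le_of_ne hb'1 fun h => absurd (hbd b' h) (not_le.2 hb')
  -- move to a nearby point outside of the exceptional set
  have hnhds : ∀ a : ℂ, a ≠ 0 → ‖a‖ < 1 → {w : ℂ | w ≠ 0 ∧ ‖w‖ ≤ 1} ∈ 𝓝 a := by
    intro a ha ha1
    filter_upwards [isOpen_ne.mem_nhds ha,
      (isOpen_lt continuous_norm continuous_const).mem_nhds ha1] with w h1 h2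
    exact ⟨h1, le_of_lt h2⟩
  obtain ⟨b, hb0, hb1, hbV, hb⟩ : ∃ b : ℂ, b ≠ 0 ∧ ‖b‖ < 1 ∧ b ∉ V ∧ 0 < f b := by
    have hc : ContinuousAt f b' := hf.continuousAt (hnhds b' hb'0 hb'2)
    have h1 : ∀ᶠ w in 𝓝[≠] b', w ≠ 0 ∧ ‖w‖ < 1 ∧ 0 < f w := by
      refine Eventually.filter_mono nhdsWithin_le_nhds ?_
      filter_upwards [isOpen_ne.mem_nhds hb'0,
        (isOpen_lt continuous_norm continuous_const).mem_nhds hb'2,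
        hc.eventually (lt_mem_nhds hb')] with w h1 h2 h3
      exact ⟨h1, h2, h3⟩
    have h2 : ∀ᶠ w in 𝓝[≠] b', w ∉ V := by
      have : (V \ {b'})ᶜ ∈ 𝓝 b' := (hV.subset Set.sdiff_subset).isClosed.isOpen_compl.mem_nhds (by simp)
      filter_upwards [nhdsWithin_le_nhds this, self_mem_nhdsWithin] with w h3 h4 h5
      exact h3 ⟨h5, h4⟩
    obtain ⟨w, h3, h4⟩ := (h1.and h2).exists
    exact ⟨w, h3.1, h3.2.1, h4, h3.2.2⟩
  -- a function vanishing at the exceptional points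
  set p : ℂ → ℂ := fun w => w * ∏ v ∈ hV.toFinset, ((w - v) / ((1 + ‖v‖ : ℝ) : ℂ)) with hp
  have hpd : Differentiable ℂ p := by
    rw [hp]
    fun_prop
  have hp1 : ∀ w : ℂ, ‖w‖ ≤ 1 → ‖p w‖ ≤ 1 := by
    intro w hw
    rw [hp]
    simp only [norm_mul, norm_prod]
    refine mul_le_one₀ hw (Finset.prod_nonneg fun _ _ => norm_nonneg _) ?_
    refine Finset.prod_le_one (fun _ _ => norm_nonneg _) fun v _ => ?_
    have : 0 < 1 + ‖v‖ := by positivity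
    rw [norm_div, Complex.norm_real, Real.norm_of_nonneg this.le, div_le_one this]
    exact (norm_sub_le w v).trans (by linarith)
  have hp0 : ∀ w, p w = 0 ↔ w = 0 ∨ w ∈ V := by
    intro w
    simp only [hp, mul_eq_zero, Finset.prod_eq_zero_iff, div_eq_zero_iff, hV.mem_toFinset]
    refine or_congr Iff.rfl ⟨?_, fun h => ⟨w, h, by simp⟩⟩
    rintro ⟨v, hv, h | h⟩
    · rwa [sub_eq_zero.1 h]
    · exfalso
      have : 0 < 1 + ‖v‖ := by positivity
      exact this.ne' (by exact_mod_cast h)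
  have hpb : p b ≠ 0 := by rw [Ne, hp0]; tauto
  set δ := f b / 2 with hδ
  have hδ0 : 0 < δ := by positivity
  have hlogb : Real.log ‖p b‖ ≤ 0 := Real.log_nonpos (norm_nonneg _) (hp1 b hb1.le)
  obtain ⟨ε, hε0, hε⟩ : ∃ ε : ℝ, 0 < ε ∧ 0 < δ + ε * Real.log ‖p b‖ := by
    refine ⟨δ / (2 * (1 - Real.log ‖p b‖)), by apply div_pos hδ0; linarith, ?_⟩
    have h2 : 0 < 1 - Real.log ‖p b‖ := by linarith
    have : δ + δ / (2 * (1 - Real.log ‖p b‖)) * Real.log ‖p b‖ =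
        δ * (2 - Real.log ‖p b‖) / (2 * (1 - Real.log ‖p b‖)) := by
      field_simp
      ring
    rw [this]
    apply div_pos (mul_pos hδ0 (by linarith)); linarith
  -- The exponential of `f + δ (‖w‖ ^ 2 - 1) + ε log ‖p‖`. In this form it extends continuously by
  -- `0` to the puncture, so a maximum exists. The term in `δ` gives strict subharmonicity, the term
  -- in `ε` keeps the maximum away from `0` and `V`, and both are small enough for `Ψ b > 1`.
  set Ψ : ℂ → ℝ := fun w => Real.exp (f w + δ * (‖w‖ ^ 2 - 1)) * ‖p w‖ ^ ε with hΨ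
  have hΨc : ContinuousOn Ψ (Metric.closedBall 0 1) := by
    intro a ha
    have ha1 : ‖a‖ ≤ 1 := by simpa using ha
    by_cases ha0 : a = 0
    · subst ha0
      have hΨ0 : Ψ 0 = 0 := by
        have : p 0 = 0 := by simp [hp]
        simp [hΨ, this, Real.zero_rpow hε0.ne']
      rw [ContinuousWithinAt, hΨ0]
      have hup : Tendsto (fun w => Real.exp (max B (f 0)) * ‖p w‖ ^ ε)
          (𝓝[Metric.closedBall 0 1] (0:ℂ)) (𝓝 0) := by
        have h1 : Continuous fun w => Real.exp (max B (f 0)) * ‖p w‖ ^ ε :=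
          continuous_const.mul ((hpd.continuous.norm).rpow_const fun _ => Or.inr hε0.le)
        have h2 := h1.tendsto 0
        have : p 0 = 0 := by simp [hp]
        rw [this, norm_zero, Real.zero_rpow hε0.ne', mul_zero] at h2
        exact h2.mono_left nhdsWithin_le_nhds
      refine tendsto_of_tendsto_of_tendsto_of_le_of_le' tendsto_const_nhds hup ?_ ?_
      · exact Eventually.of_forall fun w => by simp only [hΨ]; positivity
      · filter_upwards [self_mem_nhdsWithin] with w hw
        have hw1 : ‖w‖ ≤ 1 := by simpa using hw
        simp only [hΨ]
        refine mul_le_mul_of_nonneg_right (Real.exp_le_exp.2 ?_) (by positivity)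
        have h3 : f w ≤ max B (f 0) := by
          by_cases h : w = 0
          · rw [h]; exact le_max_right _ _
          · exact (hB w h hw1).trans (le_max_left _ _)
        have h4 : ‖w‖ ^ 2 ≤ 1 := pow_le_one₀ (norm_nonneg _) hw1
        nlinarith
    · have hfa : ContinuousWithinAt f (Metric.closedBall 0 1) a := by
        refine (hf a ⟨ha0, ha1⟩).mono_of_mem_nhdsWithin ?_
        filter_upwards [self_mem_nhdsWithin, nhdsWithin_le_nhds (isOpen_ne.mem_nhds ha0)] with w h1 h2
        exact ⟨h2, by simpa using h1⟩
      refine ContinuousWithinAt.mul ?_ ?_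
      · exact (hfa.add (by fun_prop)).rexp
      · exact ((hpd.continuous.norm).rpow_const fun _ => Or.inr hε0.le).continuousWithinAt
  obtain ⟨a, ha, hmax⟩ := (isCompact_closedBall (0:ℂ) 1).exists_isMaxOn ⟨0, by simp⟩ hΨc
  have ha1 : ‖a‖ ≤ 1 := by simpa using ha
  have hΨlog : ∀ w, p w ≠ 0 →
      Ψ w = Real.exp (f w + δ * (‖w‖ ^ 2 - 1) + ε * Real.log ‖p w‖) := by
    intro w hw
    have : 0 < ‖p w‖ := norm_pos_iff.2 hw
    simp only [hΨ]
    rw [Real.rpow_def_of_pos this, ← Real.exp_add]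
    ring_nf
  have hΨb : 1 < Ψ b := by
    rw [hΨlog b hpb, Real.one_lt_exp_iff]
    have : 0 ≤ δ * ‖b‖ ^ 2 := by positivity
    nlinarith
  have hΨa : 1 < Ψ a := hΨb.trans_le (hmax (by simpa using hb1.le))
  have hpa : p a ≠ 0 := by
    intro h
    have : Ψ a = 0 := by simp [hΨ, h, Real.zero_rpow hε0.ne']
    linarith
  have hua : 0 < f a + δ * (‖a‖ ^ 2 - 1) + ε * Real.log ‖p a‖ := by
    rwa [hΨlog a hpa, Real.one_lt_exp_iff] at hΨa
  have hloga : ε * Real.log ‖p a‖ ≤ 0 :=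
    mul_nonpos_of_nonneg_of_nonpos hε0.le (Real.log_nonpos (norm_nonneg _) (hp1 a ha1))
  have hfa : 0 < f a := by
    have h4 : ‖a‖ ^ 2 ≤ 1 := pow_le_one₀ (norm_nonneg _) ha1
    nlinarith
  have ha2 : ‖a‖ < 1 := lt_of_le_of_ne ha1 fun h => absurd (hbd a h) (not_le.2 hfa)
  have hpa' := hpa
  rw [Ne, hp0, not_or] at hpa'
  obtain ⟨g, hga, hgeq, hgle⟩ := hg a hpa'.1 ha2 hpa'.2 hfa
  have hslit : p a / p a ∈ Complex.slitPlane := by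
    rw [div_self hpa]; exact Complex.one_mem_slitPlane
  refine not_isLocalMax_re_add
    -- Here `‖w‖ ^ 2 = ‖w - a‖ ^ 2 + 2 Re (conj a * w) - ‖a‖ ^ 2`: the linear part is harmonic and
    -- is absorbed in `G`. Dividing by `p a` puts the principal logarithm at `1`.
    (G := fun w => g w + (ε : ℂ) * Complex.log (p w / p a) + 2 * (δ : ℂ) * (starRingEnd ℂ a) * w)
    (a := a) ?_ hδ0 ?_
  · have h1 : AnalyticAt ℂ (fun w => p w / p a) a :=
      (hpd.analyticAt a).div analyticAt_const hpa
    exact (hga.add (analyticAt_const.mul (h1.clog hslit))).add (analyticAt_const.mul analyticAt_id)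
  · have hpn : ∀ᶠ w in 𝓝 a, p w ≠ 0 := hpd.continuous.continuousAt.eventually_ne hpa
    filter_upwards [hgle, hpn, hnhds a hpa'.1 ha2] with w h1 h2 h3
    have h4 : Ψ w ≤ Ψ a := hmax (by simpa using h3.2)
    rw [hΨlog w h2, hΨlog a hpa, Real.exp_le_exp] at h4
    have h5 : (Complex.log (p w / p a)).re = Real.log ‖p w‖ - Real.log ‖p a‖ := by
      rw [Complex.log_re, norm_div, Real.log_div (norm_ne_zero_iff.2 h2) (norm_ne_zero_iff.2 hpa)]
    have h6 : (Complex.log (p a / p a)).re = 0 := by rw [div_self hpa]; simp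
    have h7 : ‖w - a‖ ^ 2 = ‖w‖ ^ 2 - 2 * ((starRingEnd ℂ a) * w).re + ‖a‖ ^ 2 := by
      simp only [← Complex.normSq_eq_norm_sq, Complex.normSq_apply, Complex.sub_re, Complex.sub_im,
        Complex.mul_re, Complex.conj_re, Complex.conj_im]
      ring
    have h8 : ((starRingEnd ℂ a) * a).re = ‖a‖ ^ 2 := by
      simp only [← Complex.normSq_eq_norm_sq, Complex.normSq_apply, 
        Complex.mul_re, Complex.conj_re, Complex.conj_im]
      ring
    have h9 : ∀ z : ℂ, (2 * (δ : ℂ) * (starRingEnd ℂ a) * z).re = 2 * δ * ((starRingEnd ℂ a) * z).re := by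
      intro z
      have : 2 * (δ : ℂ) * (starRingEnd ℂ a) * z = ((2 * δ : ℝ) : ℂ) * ((starRingEnd ℂ a) * z) := by
        push_cast; ring
      rw [this, Complex.re_ofReal_mul]
    simp only [Complex.add_re, h9, Complex.re_ofReal_mul, h5, h6, h8, h7]
    nlinarith

/-! ### Winding numbers -/

/-- A closed curve has winding number zero about the initial point of a path to infinity that
avoids the curve. -/
theorem exists_closed_log_sub {l : ℝ → ℂ} (hl : Continuous l) {q : ℝ → ℂ} (hq : Continuous q)
    (h : ∀ s τ, l s ≠ q τ) (hinf : Tendsto (fun τ => ‖q τ‖) atTop atTop) {x y : ℝ} (hxy : x ≤ y)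
    (hcl : l x = l y) :
    ∃ a : ℝ → ℂ, Continuous a ∧ (∀ s, Complex.exp (a s) = l s - q 0) ∧ a x = a y := by
  -- A joint logarithm over the plane of pairs `(s, τ)`. Its increment from `x` to `y` takes values
  -- in `2πiℤ`, so it is independent of `τ`; it is zero once `q τ` lies outside a disk containing
  -- the curve.
  obtain ⟨A, hA, hAe⟩ := exists_continuous_log (fun z : ℝ × ℝ => l z.1 - q z.2) (by fun_prop)
    (fun z => sub_ne_zero.2 (h _ _))
  simp only [Prod.forall] at hAe
  refine ⟨fun s => A (s, 0), by fun_prop, fun s => hAe s 0, ?_⟩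
  obtain ⟨C, hC⟩ := isCompact_Icc.exists_bound_of_continuousOn (hl.continuousOn (s := Set.Icc x y))
  obtain ⟨T, hT⟩ := (hinf.eventually_gt_atTop C).exists
  have hx : x ∈ Set.Icc x y := ⟨le_rfl, hxy⟩
  have hy : y ∈ Set.Icc x y := ⟨hxy, le_rfl⟩
  have hT0 : q T ≠ 0 := by
    have := (norm_nonneg _).trans (hC x hx)
    exact norm_pos_iff.1 (this.trans_lt hT)
  have hslit : ∀ s ∈ Set.Icc x y, 1 - l s / q T ∈ Complex.slitPlane := by
    intro s hs
    refine Complex.mem_slitPlane_of_norm_lt_one (z := -(l s / q T)) ?_ |> fun h => by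
      rwa [← sub_eq_add_neg] at h
    rw [norm_neg, norm_div, div_lt_one (norm_pos_iff.2 hT0)]
    exact (hC s hs).trans_lt hT
  have h1 : A (x, 0) - A (y, 0) = A (x, T) - A (y, T) := by
    refine eq_of_exp_eq_one isPreconnected_univ (f := fun τ : ℝ => A (x, τ) - A (y, τ))
      (by fun_prop) (fun τ _ => ?_) (Set.mem_univ _) (Set.mem_univ _)
    rw [Complex.exp_sub, hAe, hAe, hcl, div_self (sub_ne_zero.2 (h _ _))]
  have h2 := eq_of_exp_eq_one (isPreconnected_Icc (a := x) (b := y))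
    (f := fun s => A (s, T) - Complex.log (1 - l s / q T) - Complex.log (- q T)) ?_ ?_ hx hy
  · simp only [hcl] at h2
    have h3 : A (x, T) = A (y, T) := by linear_combination h2
    rw [h3, sub_self] at h1
    exact sub_eq_zero.1 h1
  · refine ((Continuous.continuousOn (by fun_prop)).sub ?_).sub continuousOn_const
    exact ContinuousOn.clog (Continuous.continuousOn (by fun_prop)) hslit
  · intro s hs
    have h3 := Complex.slitPlane_ne_zero (hslit s hs)
    rw [Complex.exp_sub, Complex.exp_sub, hAe, Complex.exp_log h3,
      Complex.exp_log (neg_ne_zero.2 hT0)]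
    have h4 : l s - q T ≠ 0 := sub_ne_zero.2 (h _ _)
    have h5 : (1 - l s / q T) * (-q T) = l s - q T := by field_simp; ring
    rw [div_div, h5, div_self h4]

/-- `A / P` and `B / Q` are both within `‖D‖ / 32` of `D`, so their ratio is within `2 / 31` of `1`.
This compares a curve near a regular point with its tangent line. -/
theorem norm_quotient_sub_one_le {A B P Q D : ℂ} (hD : D ≠ 0) (hP : P ≠ 0) (hQ : Q ≠ 0)
    (hA : ‖A - D * P‖ ≤ ‖D‖ / 32 * ‖P‖) (hB : ‖B - D * Q‖ ≤ ‖D‖ / 32 * ‖Q‖) :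
    ‖A / B * (Q / P) - 1‖ ≤ 1 / 8 := by
  have hA' : ‖A / P - D‖ ≤ ‖D‖ / 32 := by
    have : A / P - D = (A - D * P) / P := by field_simp
    rw [this, norm_div, div_le_iff₀ (norm_pos_iff.2 hP)]; exact hA
  have hB' : ‖B / Q - D‖ ≤ ‖D‖ / 32 := by
    have : B / Q - D = (B - D * Q) / Q := by field_simp
    rw [this, norm_div, div_le_iff₀ (norm_pos_iff.2 hQ)]; exact hB
  have hD' : 0 < ‖D‖ := norm_pos_iff.2 hD
  have h1 : ‖D‖ * (31 / 32) ≤ ‖B / Q‖ := by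
    have := norm_sub_norm_le D (B / Q)
    rw [norm_sub_rev] at this
    linarith
  have h2 : 0 < ‖B / Q‖ := by nlinarith
  have hBQ : B / Q ≠ 0 := norm_pos_iff.1 h2
  have hB0 : B ≠ 0 := by rintro rfl; simp at hBQ
  have : A / B * (Q / P) - 1 = ((A / P - D) - (B / Q - D)) / (B / Q) := by
    field_simp; ring
  rw [this, norm_div, div_le_iff₀ h2]
  have := norm_sub_le (A / P - D) (B / Q - D)
  linarith

theorem log_bound_of_norm_sub_one_le {z : ℂ} (hz : ‖z - 1‖ ≤ 1 / 8) :
    z ∈ Complex.slitPlane ∧ ‖Complex.log z‖ ≤ 3 / 16 := by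
  have h : z = 1 + (z - 1) := by ring
  constructor
  · rw [h]; exact Complex.mem_slitPlane_of_norm_lt_one (by linarith)
  · have := Complex.norm_log_one_add_half_le_self (z := z - 1) (by linarith)
    rw [← h] at this
    linarith

/-- The winding number of a closed curve jumps across a simple regular point of the curve, so that
it cannot vanish on both sides. -/
theorem winding_not_zero_on_both_sides {l : ℝ → ℂ} (hl : Continuous l) {x y t : ℝ} (hxt : x < t)
    (hty : t < y) (hcl : l x = l y) (hsimple : ∀ s ∈ Set.Icc x y, l s = l t → s = t) {Λ : ℂ → ℂ}
    (hΛ : AnalyticAt ℂ Λ t) (hΛ0 : deriv Λ t ≠ 0) (hloc : ∀ᶠ s : ℝ in 𝓝 t, Λ s = l s)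
    (hup : ∀ᶠ η : ℝ in 𝓝[>] 0, ∃ a : ℝ → ℂ, Continuous a ∧
      (∀ s, Complex.exp (a s) = l s - Λ (t + η * Complex.I)) ∧ a x = a y)
    (hdown : ∀ᶠ η : ℝ in 𝓝[>] 0, ∃ a : ℝ → ℂ, Continuous a ∧
      (∀ s, Complex.exp (a s) = l s - Λ (t - η * Complex.I)) ∧ a x = a y) : False := by
  set D := deriv Λ t with hD
  have hD0 : 0 < ‖D‖ := norm_pos_iff.2 hΛ0
  have hstrict : ∀ᶠ z in 𝓝 ((t : ℂ), (t : ℂ)),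
      ‖Λ z.1 - Λ z.2 - D * (z.1 - z.2)‖ ≤ ‖D‖ / 32 * ‖z.1 - z.2‖ := by
    have := hΛ.hasStrictDerivAt.hasStrictFDerivAt.isLittleO.def (c := ‖D‖ / 32) (by positivity)
    filter_upwards [this] with z hz
    simpa [mul_comm] using hz
  obtain ⟨r₀, hr₀, hstr⟩ : ∃ r₀ > 0, ∀ z z' : ℂ, ‖z - t‖ < r₀ → ‖z' - t‖ < r₀ →
      ‖Λ z - Λ z' - D * (z - z')‖ ≤ ‖D‖ / 32 * ‖z - z'‖ := by
    obtain ⟨r₀, hr₀, h⟩ := Metric.eventually_nhds_iff.1 hstrict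
    refine ⟨r₀, hr₀, fun z z' hz hz' => @h (z, z') ?_⟩
    rw [Prod.dist_eq]
    exact max_lt (by rwa [dist_eq_norm]) (by rwa [dist_eq_norm])
  obtain ⟨r₁, hr₁, hlo⟩ := Metric.eventually_nhds_iff.1 hloc
  obtain ⟨r, hr, hrr₀, hrr₁, hrx, hry⟩ : ∃ r > 0, r < r₀ ∧ r < r₁ ∧ x < t - r ∧ t + r < y := by
    have h1 : 0 < min (min r₀ r₁) (min (t - x) (y - t)) := by
      refine lt_min (lt_min hr₀ hr₁) (lt_min (by linarith) (by linarith))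
    refine ⟨min (min r₀ r₁) (min (t - x) (y - t)) / 2, by positivity, ?_, ?_, ?_, ?_⟩
    · have := (min_le_left (min r₀ r₁) (min (t - x) (y - t))).trans (min_le_left _ _); linarith
    · have := (min_le_left (min r₀ r₁) (min (t - x) (y - t))).trans (min_le_right _ _); linarith
    · have := (min_le_right (min r₀ r₁) (min (t - x) (y - t))).trans (min_le_left _ _); linarith
    · have := (min_le_right (min r₀ r₁) (min (t - x) (y - t))).trans (min_le_right _ _); linarith
  have hlΛ : ∀ s : ℝ, |s - t| ≤ r → Λ s = l s := fun s hs => hlo (by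
    rw [Real.dist_eq]; linarith)
  have hlt : Λ t = l t := hlΛ t (by simpa using hr.le)
  -- Simplicity at `t` and compactness keep the rest of the curve away from `l t`; there the
  -- quotient `R` below is close to `1`.
  obtain ⟨m, hm, hml⟩ : ∃ m > 0, ∀ s ∈ Set.Icc x y, r ≤ |s - t| → m ≤ ‖l s - l t‖ := by
    have hK : IsCompact (Set.Icc x y ∩ {s | r ≤ |s - t|}) :=
      isCompact_Icc.inter_right (isClosed_le (by fun_prop) (by fun_prop))
    obtain ⟨s₀, ⟨hs₀, hs₀r⟩, hmin⟩ := hK.exists_isMinOn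
      ⟨t - r, ⟨hrx.le, by linarith⟩, by simp [abs_of_pos hr]⟩
      (f := fun s => ‖l s - l t‖) (by fun_prop)
    refine ⟨‖l s₀ - l t‖, ?_, fun s hs hsr => hmin ⟨hs, hsr⟩⟩
    rw [gt_iff_lt, norm_pos_iff, sub_ne_zero]
    intro h
    have := hsimple s₀ hs₀ h
    simp only [this, sub_self, abs_zero, Set.mem_ofPred_eq] at hs₀r
    linarith
  have hnear : ∀ σ : ℝ, ∀ᶠ η : ℝ in 𝓝[>] 0, ‖Λ (t + σ * η * Complex.I) - Λ t‖ < m / 32 := by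
    intro σ
    have hc : Tendsto (fun η : ℝ => (t : ℂ) + σ * η * Complex.I) (𝓝 0) (𝓝 t) := by
      have : Continuous (fun η : ℝ => (t : ℂ) + σ * η * Complex.I) := by fun_prop
      simpa using this.tendsto 0
    have := (hΛ.continuousAt.tendsto.comp hc).eventually (Metric.ball_mem_nhds _ (ε := m / 32) (by positivity))
    filter_upwards [this.filter_mono nhdsWithin_le_nhds] with η h
    simpa [dist_eq_norm] using h
  obtain ⟨η, ⟨a₁, ha₁, ha₁e, ha₁c⟩, ⟨a₂, ha₂, ha₂e, ha₂c⟩, hn₁, hn₂, hη, hηr⟩ :=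
    (hup.and (hdown.and ((hnear 1).and ((hnear (-1)).and
      ((eventually_mem_nhdsWithin).and (nhdsWithin_le_nhds (gt_mem_nhds hr))))))).exists
  replace hη : 0 < η := hη
  set p₁ := Λ (t + η * Complex.I)
  set p₂ := Λ (t - η * Complex.I)
  have hn₁' : ‖p₁ - l t‖ < m / 32 := by simpa [hlt] using hn₁
  have hn₂' : ‖p₂ - l t‖ < m / 32 := by simpa [hlt, ← sub_eq_add_neg] using hn₂
  have hne₁ : ∀ s, l s - p₁ ≠ 0 := fun s => ha₁e s ▸ Complex.exp_ne_zero _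
  have hne₂ : ∀ s, l s - p₂ ≠ 0 := fun s => ha₂e s ▸ Complex.exp_ne_zero _
  set R : ℝ → ℂ := fun s => (l s - p₁) / (l s - p₂) with hR
  have hRc : Continuous R := by
    rw [hR]; exact Continuous.div (by fun_prop) (by fun_prop) hne₂
  have hae : ∀ s, Complex.exp (a₁ s - a₂ s) = R s := fun s => by
    rw [Complex.exp_sub, ha₁e, ha₂e]
  have hRne : ∀ s, R s ≠ 0 := fun s => div_ne_zero (hne₁ s) (hne₂ s)
  -- away from the simple point
  have hout : ∀ s ∈ Set.Icc x y, r ≤ |s - t| → ‖R s - 1‖ ≤ 1 / 8 := by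
    intro s hs hsr
    have h1 : R s - 1 = (p₂ - l t - (p₁ - l t)) / (l s - p₂) := by
      simp only [hR]
      rw [div_sub_one (hne₂ s)]
      ring_nf
    have h2 := norm_sub_le (p₂ - l t) (p₁ - l t)
    have h3 := norm_sub_norm_le (l s - l t) (p₂ - l t)
    rw [sub_sub_sub_cancel_right] at h3
    have h4 := hml s hs hsr
    rw [h1, norm_div, div_le_iff₀ (norm_pos_iff.2 (hne₂ s))]
    linarith
  have hside : ∀ u v, x ≤ u → v ≤ y → u ≤ v → (∀ s ∈ Set.Icc u v, r ≤ |s - t|) →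
      a₁ u - a₂ u - Complex.log (R u) = a₁ v - a₂ v - Complex.log (R v) := by
    intro u v hu hv huv hs
    refine eq_of_exp_eq_one (isPreconnected_Icc (a := u) (b := v))
      (f := fun s => a₁ s - a₂ s - Complex.log (R s)) ?_ ?_ ⟨le_rfl, huv⟩ ⟨huv, le_rfl⟩
    · refine (Continuous.continuousOn (by fun_prop)).sub (hRc.continuousOn.clog fun s h => ?_)
      exact (log_bound_of_norm_sub_one_le (hout s ⟨hu.trans h.1, h.2.trans hv⟩ (hs s h))).1
    · intro s _
      rw [Complex.exp_sub, hae, Complex.exp_log (hRne s), div_self (hRne s)]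
  have hleft := hside x (t - r) le_rfl (by linarith) hrx.le fun s hs => by
    rw [abs_of_nonpos (by linarith [hs.2])]; linarith [hs.2]
  have hright := hside (t + r) y (by linarith) le_rfl hry.le fun s hs => by
    rw [abs_of_nonneg (by linarith [hs.1])]; linarith [hs.1]
  have hRxy : R x = R y := by simp only [hR, hcl]
  -- near the simple point
  set P : ℝ → ℂ := fun s => (s - t : ℂ) - η * Complex.I with hP
  set Q : ℝ → ℂ := fun s => (s - t : ℂ) + η * Complex.I with hQ
  have hPne : ∀ s, P s ≠ 0 := fun s h => by
    have := congrArg Complex.im h; simp [hP] at this; exact hη.ne' this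
  have hQne : ∀ s, Q s ≠ 0 := fun s h => by
    have := congrArg Complex.im h; simp [hQ] at this; exact hη.ne' this
  set ρ : ℝ → ℂ := fun s => R s * (Q s / P s) with hρ
  have hρc : Continuous ρ :=
    hRc.mul (Continuous.div (by simp only [hQ]; fun_prop) (by simp only [hP]; fun_prop) hPne)
  have hρne : ∀ s, ρ s ≠ 0 := fun s => mul_ne_zero (hRne s) (div_ne_zero (hQne s) (hPne s))
  have hin : ∀ s, |s - t| ≤ r → ‖ρ s - 1‖ ≤ 1 / 8 := by
    intro s hs
    have hs0 : ‖(s : ℂ) - t‖ < r₀ := by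
      rw [← Complex.ofReal_sub, Complex.norm_real, Real.norm_eq_abs]; linarith
    refine norm_quotient_sub_one_le hΛ0 (hPne s) (hQne s) ?_ ?_
    · have h1 := hstr s (t + η * Complex.I) hs0 (by simp [abs_of_pos hη]; linarith)
      rw [hlΛ s hs, ← sub_sub (s : ℂ)] at h1
      exact h1
    · have h1 := hstr s (t - η * Complex.I) hs0 (by simp [abs_of_pos hη]; linarith)
      rw [hlΛ s hs, ← sub_add (s : ℂ)] at h1
      exact h1
  -- An explicit logarithm of `-(P / Q)`, the quotient for the straight line. It runs from `-c` to
  -- `c`, with `c` near `πi` when `η` is small compared with `r`: this is the jump of the winding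
  -- number.
  set b : ℝ → ℂ := fun s => Complex.log (η + (s - t) * Complex.I) -
    Complex.log (η - (s - t) * Complex.I) with hb
  have hslit₁ : ∀ s : ℝ, (η + (s - t) * Complex.I : ℂ) ∈ Complex.slitPlane := fun s =>
    Or.inl (by simpa using hη)
  have hslit₂ : ∀ s : ℝ, (η - (s - t) * Complex.I : ℂ) ∈ Complex.slitPlane := fun s =>
    Or.inl (by simpa using hη)
  have hbc : Continuous b :=
    (Continuous.clog (by fun_prop) hslit₁).sub (Continuous.clog (by fun_prop) hslit₂)
  have hbe : ∀ s : ℝ, Complex.exp (b s) = - (P s / Q s) := by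
    intro s
    have h1 := Complex.slitPlane_ne_zero (hslit₁ s)
    have h2 := Complex.slitPlane_ne_zero (hslit₂ s)
    simp only [hb]
    rw [Complex.exp_sub, Complex.exp_log h1, Complex.exp_log h2, ← neg_div,
      div_eq_div_iff h2 (hQne s)]
    simp only [hP, hQ]
    ring_nf
    simp only [Complex.I_sq]
    ring
  have hmid := eq_of_exp_eq_one (isPreconnected_Icc (a := t - r) (b := t + r))
    (f := fun s => a₁ s - a₂ s - Complex.log (ρ s) - b s - Real.pi * Complex.I) (by
      refine (((Continuous.continuousOn (by fun_prop)).sub (hρc.continuousOn.clog fun s h => ?_)).sub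
        hbc.continuousOn).sub continuousOn_const
      exact (log_bound_of_norm_sub_one_le (hin s (abs_le.2 ⟨by linarith [h.1], by linarith [h.2]⟩))).1)
    (by
      intro s _
      rw [Complex.exp_sub, Complex.exp_sub, Complex.exp_sub, hae, Complex.exp_log (hρne s), hbe,
        Complex.exp_pi_mul_I]
      have h1 := hRne s
      have h2 := hPne s
      have h3 := hQne s
      simp only [hρ]
      field_simp)
    (x := t - r) (y := t + r) ⟨le_rfl, by linarith⟩ ⟨by linarith, le_rfl⟩
  have hl1 := (log_bound_of_norm_sub_one_le (hout (t - r) ⟨by linarith, by linarith⟩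
    (by simp [abs_of_pos hr]))).2
  have hl2 := (log_bound_of_norm_sub_one_le (hout (t + r) ⟨by linarith, by linarith⟩
    (by simp [abs_of_pos hr]))).2
  have hl3 := (log_bound_of_norm_sub_one_le (hin (t - r) (by simp [abs_of_pos hr]))).2
  have hl4 := (log_bound_of_norm_sub_one_le (hin (t + r) (by simp [abs_of_pos hr]))).2
  set c : ℂ := Complex.log (η + r * Complex.I) - Complex.log (η - r * Complex.I) with hc
  have hb1 : b (t + r) = c := by simp [hb, hc]
  have hb2 : b (t - r) = - c := by simp [hb, hc, sub_eq_add_neg, add_comm]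
  -- Both logarithms close up, so only four corrections of size at most `3 / 16` remain. They force
  -- `‖c‖ ≤ 3 / 8` and `‖exp c - 1‖ ≤ 3 / 4`, while `η < r` gives `‖exp c - 1‖ ≥ 1`.
  have hsum : 2 * c = Complex.log (R (t + r)) - Complex.log (R (t - r)) -
      (Complex.log (ρ (t + r)) - Complex.log (ρ (t - r))) := by
    simp only [hb1, hb2] at hmid
    rw [hRxy, ha₁c, ha₂c] at hleft
    linear_combination hmid + hleft + hright
  have hcn : ‖c‖ ≤ 3 / 8 := by
    have h1 := norm_sub_le (Complex.log (R (t + r)) - Complex.log (R (t - r)))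
      (Complex.log (ρ (t + r)) - Complex.log (ρ (t - r)))
    have h2 := norm_sub_le (Complex.log (R (t + r))) (Complex.log (R (t - r)))
    have h3 := norm_sub_le (Complex.log (ρ (t + r))) (Complex.log (ρ (t - r)))
    rw [← hsum, norm_mul] at h1
    norm_num at h1
    linarith
  have hce : Complex.exp c - 1 = 2 * r * Complex.I / (η - r * Complex.I) := by
    have h1 : (η + r * Complex.I : ℂ) ≠ 0 := by simpa using Complex.slitPlane_ne_zero (hslit₁ (t + r))
    have h2 : (η - r * Complex.I : ℂ) ≠ 0 := by simpa using Complex.slitPlane_ne_zero (hslit₂ (t + r))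
    rw [hc, Complex.exp_sub, Complex.exp_log h1, Complex.exp_log h2, div_sub_one h2]
    ring
  have h1 := Complex.norm_exp_sub_one_le (x := c) (by linarith)
  have h2 : ‖(η - r * Complex.I : ℂ)‖ ≤ 2 * r := by
    refine (norm_sub_le _ _).trans ?_
    simp [abs_of_pos hη, abs_of_pos hr]; linarith
  have h3 : 0 < ‖(η - r * Complex.I : ℂ)‖ := by
    rw [norm_pos_iff]; simpa using Complex.slitPlane_ne_zero (hslit₂ (t + r))
  have h4 : 1 ≤ ‖Complex.exp c - 1‖ := by
    rw [hce, norm_div, le_div_iff₀ h3]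
    simpa [abs_of_pos hr] using h2
  linarith

end

noncomputable section

/-! ### Points of the glued surface -/

theorem continuous_toHalfPlane : Continuous toHalfPlane := by
  have h : Continuous fun z : ℂ => (z.re : ℂ) + ((max z.im 0 : ℝ) : ℂ) * Complex.I := by fun_prop
  refine Continuous.subtype_mk (h.congr fun z => ?_) _
  apply Complex.ext <;> simp

theorem coe_toHalfPlane {z : ℂ} (hz : 0 ≤ z.im) : (toHalfPlane z : ℂ) = z := by
  apply Complex.ext <;> simp [toHalfPlane, hz]

theorem toHalfPlane_coe (z : ClosedHalfPlane) : toHalfPlane (z : ℂ) = z :=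
  Subtype.ext (coe_toHalfPlane z.2)

theorem toHalfPlane_inj {z z' : ℂ} (hz : 0 ≤ z.im) (hz' : 0 ≤ z'.im) :
    toHalfPlane z = toHalfPlane z' ↔ z = z' := by
  rw [Subtype.ext_iff, coe_toHalfPlane hz, coe_toHalfPlane hz']

namespace PlanarGluing

variable {k : ℕ} (G : PlanarGluing k)

theorem mem_I_rev {e : Fin G.n} {x : ℝ} : x ∈ G.I (G.rev e) ↔ G.shift e - x ∈ G.I e := by
  rw [G.I_rev]
  constructor
  · rintro ⟨y, hy, rfl⟩; simpa using hy
  · intro h; exact ⟨_, h, by simp⟩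

theorem mem_interior_I_rev {e : Fin G.n} {x : ℝ} (hx : x ∈ interior (G.I e)) :
    G.shift e - x ∈ interior (G.I (G.rev e)) := by
  rw [mem_interior_iff_mem_nhds] at hx ⊢
  have hc : Tendsto (fun y => G.shift e - y) (𝓝 (G.shift e - x)) (𝓝 x) := by
    have : Continuous (fun y => G.shift e - y) := by fun_prop
    simpa using this.tendsto (G.shift e - x)
  filter_upwards [hc hx] with y hy
  exact G.mem_I_rev.2 hy

/-- A nondegenerate interval lies in the closure of its interior, so meeting an open edge would make
the two interiors intersect. -/
theorem eq_of_mem_interior {e f : Fin G.n} (h : G.side f = G.side e) {x : ℝ}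
    (hx : x ∈ interior (G.I e)) (hf : x ∈ G.I f) : f = e := by
  by_contra hne
  have hd := G.disjoint_I f e hne h
  have hconv : Convex ℝ (G.I f) := convex_iff_ordConnected.2 (G.ordConnected_I f)
  have hcl : x ∈ closure (interior (G.I f)) := by
    rw [hconv.closure_interior_eq_closure_of_nonempty_interior (G.interior_I f)]
    exact subset_closure hf
  obtain ⟨y, hy1, hy2⟩ := mem_closure_iff.1 hcl _ isOpen_interior hx
  exact Set.disjoint_left.1 hd hy2 hy1

variable {G} in
theorem Glued.symm {p q : ZMod k × ClosedHalfPlane} (h : G.Glued p q) : G.Glued q p := by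
  obtain ⟨e, h1, h2, h3, h4, h5⟩ := h
  have hq : (q.2 : ℂ).re = G.shift e - (p.2 : ℂ).re := by rw [h5]; simp
  refine ⟨G.rev e, h2, by rw [G.rev_rev, h1], by rw [h5]; simp [h3], ?_, ?_⟩
  · rw [G.mem_I_rev, hq]; simpa using h4
  · rw [G.shift_rev, h5]; ring

/-- `Glued` is symmetric, so a set stable under it is a union of gluing classes. Small stable sets
`S` then determine the classes explicitly. -/
theorem mem_of_pt_eq {S : Set (ZMod k × ClosedHalfPlane)}
    (hS : ∀ p q, G.Glued p q → p ∈ S → q ∈ S) {i j : ZMod k} {z z' : ClosedHalfPlane}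
    (h : G.pt j z = G.pt i z') (hz : (j, z) ∈ S) : (i, z') ∈ S := by
  have h1 : Relation.EqvGen G.Glued (j, z) (i, z') := Quotient.exact h
  have h2 : ∀ p q, Relation.EqvGen G.Glued p q → (p ∈ S ↔ q ∈ S) := by
    intro p q h
    induction h with
    | rel p q h => exact ⟨hS p q h, hS q p h.symm⟩
    | refl => rfl
    | symm _ _ _ ih => exact ih.symm
    | trans _ _ _ _ _ ih₁ ih₂ => exact ih₁.trans ih₂
  exact (h2 _ _ h1).1 hz

theorem exists_pt (p : G.Surface) : ∃ (j : ZMod k) (z : ℂ), 0 ≤ z.im ∧ p = G.pt j (toHalfPlane z) := by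
  obtain ⟨⟨j, z⟩, rfl⟩ := Quotient.exists_rep p
  exact ⟨j, z, z.2, by rw [toHalfPlane_coe]; rfl⟩

/-- Points of the open half-planes are not glued to anything. -/
theorem pt_eq_of_im_pos {i j : ZMod k} {z z' : ℂ} (hz : 0 < z.im) (hz' : 0 ≤ z'.im)
    (h : G.pt j (toHalfPlane z) = G.pt i (toHalfPlane z')) : i = j ∧ z' = z := by
  have := G.mem_of_pt_eq (S := {(j, toHalfPlane z)}) ?_ h rfl
  · have h2 := Prod.ext_iff.1 (Set.mem_singleton_iff.1 this)
    exact ⟨h2.1, (toHalfPlane_inj hz' hz.le).1 h2.2⟩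
  · rintro p q ⟨e, -, -, h3, -, -⟩ rfl
    simp only [coe_toHalfPlane hz.le] at h3
    exact absurd h3 hz.ne'

/-- The unglued points of the boundary lines. -/
theorem pt_eq_of_unglued {i j : ZMod k} {x : ℝ} (hx : ∀ e, G.side e = j → x ∉ G.I e) {z : ℂ}
    (hz : 0 ≤ z.im) (h : G.pt j (toHalfPlane x) = G.pt i (toHalfPlane z)) : i = j ∧ z = x := by
  have := G.mem_of_pt_eq (S := {(j, toHalfPlane x)}) ?_ h rfl
  · have h2 := Prod.ext_iff.1 (Set.mem_singleton_iff.1 this)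
    exact ⟨h2.1, (toHalfPlane_inj hz (by simp)).1 h2.2⟩
  · rintro p q ⟨e, h1, -, -, h4, -⟩ rfl
    rw [coe_toHalfPlane (by simp)] at h4
    exact absurd (by simpa using h4) (hx e h1.symm)

/-- The points glued to an interior point of an edge. -/
theorem pt_eq_of_mem_interior {e : Fin G.n} {x : ℝ} (hx : x ∈ interior (G.I e)) {i : ZMod k} {z : ℂ}
    (hz : 0 ≤ z.im) (h : G.pt (G.side e) (toHalfPlane x) = G.pt i (toHalfPlane z)) :
    (i = G.side e ∧ z = x) ∨ (i = G.side (G.rev e) ∧ z = (G.shift e : ℂ) - x) := by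
  have hi1 : 0 ≤ (x : ℂ).im := by simp
  have hi2 : 0 ≤ ((G.shift e : ℂ) - x).im := by simp
  have hx' := G.mem_interior_I_rev hx
  have := G.mem_of_pt_eq (S := {(G.side e, toHalfPlane x),
    (G.side (G.rev e), toHalfPlane ((G.shift e : ℂ) - x))}) ?_ h (Or.inl rfl)
  · rcases this with h2 | h2
    · have h2 := Prod.ext_iff.1 h2
      exact Or.inl ⟨h2.1, (toHalfPlane_inj hz hi1).1 h2.2⟩
    · have h2 := Prod.ext_iff.1 (Set.mem_singleton_iff.1 h2)
      exact Or.inr ⟨h2.1, (toHalfPlane_inj hz hi2).1 h2.2⟩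
  · rintro p ⟨q1, q2⟩ ⟨f, h1, h2, h3, h4, h5⟩ (rfl | hp)
    · have hf : f = e := G.eq_of_mem_interior h1.symm hx
        (by simpa [coe_toHalfPlane hi1] using h4)
      subst hf
      right
      refine Prod.ext h2 (Subtype.ext ?_)
      rw [coe_toHalfPlane hi2]
      simpa [coe_toHalfPlane hi1] using h5
    · rw [Set.mem_singleton_iff] at hp
      subst hp
      have hf : f = G.rev e := G.eq_of_mem_interior h1.symm hx'
        (by simpa [coe_toHalfPlane hi2] using h4)
      subst hf
      left
      refine Prod.ext (by simpa [G.rev_rev] using h2) (Subtype.ext ?_)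
      rw [coe_toHalfPlane hi1]
      simpa [coe_toHalfPlane hi2, G.shift_rev] using h5

theorem continuous_pt (j : ZMod k) : Continuous (G.pt j) := by
  let : TopologicalSpace (ZMod k) := ⊥
  exact (continuous_quot_mk : Continuous (Quot.mk G.setoid)).comp (Continuous.prodMk_right j)

/-- The distance of a point of the surface from the boundary of the half-plane it lies in. -/
def height : G.Surface → ℝ :=
  Quotient.lift (fun p : ZMod k × ClosedHalfPlane => (p.2 : ℂ).im) (by
    intro p q h
    change Relation.EqvGen G.Glued p q at h
    induction h with
    | rel p q h =>
      obtain ⟨e, -, -, him, -, hq⟩ := h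
      rw [hq]
      simp [him]
    | refl => rfl
    | symm _ _ _ ih => exact ih.symm
    | trans _ _ _ _ _ ih₁ ih₂ => exact ih₁.trans ih₂)

theorem height_pt (j : ZMod k) {z : ℂ} (hz : 0 ≤ z.im) :
    G.height (G.pt j (toHalfPlane z)) = z.im := by
  change (toHalfPlane z : ℂ).im = _
  rw [coe_toHalfPlane hz]

theorem height_nonneg (p : G.Surface) : 0 ≤ G.height p := by
  obtain ⟨j, z, hz, rfl⟩ := G.exists_pt p
  rwa [G.height_pt j hz]

theorem continuous_height : Continuous G.height := by
  let : TopologicalSpace (ZMod k) := ⊥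
  exact continuous_quot_lift _ (by fun_prop)

theorem height_of_mem_boundary {p : G.Surface} (hp : p ∈ G.boundary) : G.height p = 0 := by
  obtain ⟨j, x, -, rfl⟩ := hp
  rw [G.height_pt j (by simp)]
  simp

theorem collapse_pt [NeZero k] (j : ZMod k) {z : ℂ} (hz : 0 ≤ z.im) :
    G.collapse (G.pt j (toHalfPlane z)) = prong j z.im hz := by
  change prong j (toHalfPlane z : ℂ).im (toHalfPlane z).2 = _
  congr 1
  rw [coe_toHalfPlane hz]

theorem edgeChart_of_nonneg (e : Fin G.n) {z : ℂ} (hz : 0 ≤ z.im) :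
    G.edgeChart e z = G.pt (G.side e) (toHalfPlane z) := if_pos hz

theorem edgeChart_of_neg (e : Fin G.n) {z : ℂ} (hz : z.im < 0) :
    G.edgeChart e z = G.pt (G.side (G.rev e)) (toHalfPlane ((G.shift e : ℂ) - z)) :=
  if_neg (not_le.2 hz)

theorem height_edgeChart (e : Fin G.n) (z : ℂ) : G.height (G.edgeChart e z) = |z.im| := by
  rcases le_or_gt 0 z.im with hz | hz
  · rw [G.edgeChart_of_nonneg e hz, G.height_pt _ hz, abs_of_nonneg hz]
  · rw [G.edgeChart_of_neg e hz, G.height_pt _ (by simpa using hz.le), abs_of_neg hz]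
    simp

/-- The domain of the flat coordinate around an open edge. -/
def strip (e : Fin G.n) : Set ℂ := {z | z.re ∈ interior (G.I e)}

theorem isOpen_strip (e : Fin G.n) : IsOpen (G.strip e) :=
  isOpen_interior.preimage Complex.continuous_re

/-- The only danger is a collision of the upper with the lower side when the edge is glued within
one boundary line; `hdisj` excludes it, because distinct intervals on one line have disjoint
interiors. -/
theorem injOn_edgeChart (e : Fin G.n) : Set.InjOn (G.edgeChart e) (G.strip e) := by
  have hdisj : ∀ x y : ℝ, x ∈ interior (G.I e) → y ∈ interior (G.I e) →
      G.side (G.rev e) = G.side e → x ≠ G.shift e - y := by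
    intro x y hx hy hs h
    have h1 := G.mem_interior_I_rev hy
    rw [← h] at h1
    exact G.rev_ne e (G.eq_of_mem_interior hs hx (interior_subset h1))
  have key : ∀ z z' : ℂ, z ∈ G.strip e → z' ∈ G.strip e → G.edgeChart e z = G.edgeChart e z' →
      z.im ≠ 0 → z = z' := by
    intro z z' hz hz' h h0
    rcases lt_or_gt_of_ne h0 with h0 | h0
    · have h0' : 0 < ((G.shift e : ℂ) - z).im := by simpa using h0
      rw [G.edgeChart_of_neg e h0] at h
      rcases le_or_gt 0 z'.im with h1 | h1
      · rw [G.edgeChart_of_nonneg e h1] at h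
        obtain ⟨h2, h3⟩ := G.pt_eq_of_im_pos h0' h1 h
        have := congrArg Complex.re h3
        simp only [Complex.sub_re, Complex.ofReal_re] at this
        exact absurd this (hdisj _ _ hz' hz h2.symm)
      · rw [G.edgeChart_of_neg e h1] at h
        obtain ⟨h2, h3⟩ := G.pt_eq_of_im_pos h0' (by simpa using h1.le) h
        exact (sub_right_inj.1 h3).symm
    · rw [G.edgeChart_of_nonneg e h0.le] at h
      rcases le_or_gt 0 z'.im with h1 | h1
      · rw [G.edgeChart_of_nonneg e h1] at h
        exact (G.pt_eq_of_im_pos h0 h1 h).2.symm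
      · rw [G.edgeChart_of_neg e h1] at h
        obtain ⟨h2, h3⟩ := G.pt_eq_of_im_pos h0 (by simpa using h1.le) h
        have := congrArg Complex.re h3
        simp only [Complex.sub_re, Complex.ofReal_re] at this
        exact absurd this.symm (hdisj _ _ hz hz' h2)
  intro z hz z' hz' h
  by_cases h0 : z.im = 0
  · by_cases h1 : z'.im = 0
    · obtain ⟨x, rfl⟩ : ∃ x : ℝ, (x : ℂ) = z := ⟨z.re, Complex.ext rfl (by simp [h0])⟩
      obtain ⟨y, rfl⟩ : ∃ x : ℝ, (x : ℂ) = z' := ⟨z'.re, Complex.ext rfl (by simp [h1])⟩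
      rw [G.edgeChart_of_nonneg e (by simp), G.edgeChart_of_nonneg e (by simp)] at h
      rcases G.pt_eq_of_mem_interior (by simpa [strip] using hz) (by simp) h with h2 | h2
      · exact h2.2.symm
      · have h3 : y = G.shift e - x := by exact_mod_cast h2.2
        exact absurd h3 (hdisj _ _ (by simpa [strip] using hz') (by simpa [strip] using hz) h2.1.symm)
    · exact (key z' z hz' hz h.symm h1).symm
  · exact key z z' hz hz' h h0

theorem finite_frontier_I (e : Fin G.n) : (G.I e \ interior (G.I e)).Finite := by
  have : G.I e \ interior (G.I e) ⊆ {x | IsLeast (G.I e) x} ∪ {x | IsGreatest (G.I e) x} := by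
    rintro x ⟨hx, hx'⟩
    by_contra h
    simp only [Set.mem_union, Set.mem_ofPred_eq, not_or, IsLeast, IsGreatest, lowerBounds,
      upperBounds, hx, true_and, not_forall, not_le] at h
    obtain ⟨⟨a, ha, hax⟩, ⟨b, hb, hxb⟩⟩ := h
    refine hx' (mem_interior_iff_mem_nhds.2 (mem_of_superset (Icc_mem_nhds hax hxb) ?_))
    exact (G.ordConnected_I e).out ha hb
  refine Set.Finite.subset (Set.Finite.union ?_ ?_) this
  · exact Set.Subsingleton.finite fun x hx y hy => IsLeast.unique hx hy
  · exact Set.Subsingleton.finite fun x hx y hy => IsGreatest.unique hx hy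

end PlanarGluing

/-! ### Coordinates on the punctured disk -/

namespace Uniformization

variable {k : ℕ} {G : PlanarGluing k} {θ : ℝ} (u : Uniformization G θ)

/-- The inverse of the uniformization, extended to the plane by an arbitrary constant. -/
def inv (w : ℂ) : G.Surface :=
  if h : w ≠ 0 ∧ ‖w‖ ≤ 1 then u.φ.symm ⟨w, h⟩ else u.φ.symm ⟨1, by simp⟩

theorem inv_eq (w : ClosedPuncturedDisk) : u.inv w = u.φ.symm w := dif_pos w.2

theorem φ_inv {w : ℂ} (h0 : w ≠ 0) (h1 : ‖w‖ ≤ 1) : (u.φ (u.inv w) : ℂ) = w := by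
  rw [u.inv_eq ⟨w, h0, h1⟩, Homeomorph.apply_symm_apply]

theorem inv_φ (p : G.Surface) : u.inv (u.φ p) = p := by
  rw [u.inv_eq, Homeomorph.symm_apply_apply]

theorem φ_injective {p q : G.Surface} (h : (u.φ p : ℂ) = u.φ q) : p = q :=
  u.φ.injective (Subtype.ext h)

theorem continuousOn_inv : ContinuousOn u.inv {w : ℂ | w ≠ 0 ∧ ‖w‖ ≤ 1} := by
  rw [continuousOn_iff_continuous_domRestrict]
  exact u.φ.symm.continuous.congr fun w => (u.inv_eq w).symm

theorem norm_lt_one {p : G.Surface} (hp : 0 < G.height p) : ‖(u.φ p : ℂ)‖ < 1 := by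
  refine lt_of_le_of_ne (u.φ p).2.2 fun h => ?_
  exact hp.ne' (G.height_of_mem_boundary ((u.norm_eq_one_iff p).1 h))

theorem height_inv_of_norm_eq_one {w : ℂ} (hw : ‖w‖ = 1) : G.height (u.inv w) = 0 := by
  refine G.height_of_mem_boundary ((u.norm_eq_one_iff _).1 ?_)
  rw [u.φ_inv (by rintro rfl; simp at hw) hw.le, hw]

theorem continuous_φ_pt (j : ZMod k) :
    Continuous fun z : ℂ => (u.φ (G.pt j (toHalfPlane z)) : ℂ) :=
  continuous_subtype_val.comp (u.φ.continuous.comp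
    ((G.continuous_pt j).comp continuous_toHalfPlane))

/-- The coordinate of a half-plane, as a function on the punctured disk. -/
theorem exists_halfPlane_coordinate (j : ZMod k) {a : ℂ} (ha : 0 < a.im) :
    ∃ ζ : ℂ → ℂ, AnalyticAt ℂ ζ (u.φ (G.pt j (toHalfPlane a))) ∧
      ζ (u.φ (G.pt j (toHalfPlane a))) = a ∧ ∀ᶠ w in 𝓝 (u.φ (G.pt j (toHalfPlane a)) : ℂ),
        0 < (ζ w).im ∧ u.inv w = G.pt j (toHalfPlane (ζ w)) := by
  obtain ⟨ζ, h1, h2, h3⟩ := exists_analytic_localInverse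
    (isOpen_lt continuous_const Complex.continuous_im) (u.holo_halfPlane j)
    (fun z hz z' hz' h => ((G.pt_eq_of_im_pos hz (le_of_lt hz') (u.φ_injective h)).2).symm) ha
  refine ⟨ζ, h1, h2, h3.mono fun w hw => ⟨hw.1, ?_⟩⟩
  rw [← u.inv_φ (G.pt j (toHalfPlane (ζ w))), hw.2]

/-- Off the real axis this is conformality in the half-planes, turned by `z ↦ shift e - z` below the
axis; on the axis it is conformality across the edge. -/
theorem differentiableOn_edgeChart (e : Fin G.n) :
    DifferentiableOn ℂ (fun z : ℂ => (u.φ (G.edgeChart e z) : ℂ)) (G.strip e) := by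
  intro z hz
  refine DifferentiableAt.differentiableWithinAt ?_
  rcases lt_trichotomy z.im 0 with h | h | h
  · have h1 : DifferentiableAt ℂ (fun z : ℂ =>
        (u.φ (G.pt (G.side (G.rev e)) (toHalfPlane ((G.shift e : ℂ) - z))) : ℂ)) z := by
      have h2 := (u.holo_halfPlane (G.side (G.rev e))).differentiableAt (x := (G.shift e : ℂ) - z)
        ((isOpen_lt continuous_const Complex.continuous_im).mem_nhds (by simpa using h))
      exact h2.comp z (by fun_prop : DifferentiableAt ℂ (fun z : ℂ => (G.shift e : ℂ) - z) z)
    refine h1.congr_of_eventuallyEq ?_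
    filter_upwards [(isOpen_lt Complex.continuous_im continuous_const).mem_nhds h] with w hw
    rw [G.edgeChart_of_neg e hw]
  · have : z = (z.re : ℂ) := Complex.ext rfl (by simp [h])
    rw [this]
    exact u.holo_edge e z.re hz
  · have h1 := (u.holo_halfPlane (G.side e)).differentiableAt (x := z)
        ((isOpen_lt continuous_const Complex.continuous_im).mem_nhds h)
    refine h1.congr_of_eventuallyEq ?_
    filter_upwards [(isOpen_lt continuous_const Complex.continuous_im).mem_nhds h] with w hw
    rw [G.edgeChart_of_nonneg e (le_of_lt hw)]

theorem injOn_φ_edgeChart (e : Fin G.n) :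
    Set.InjOn (fun z : ℂ => (u.φ (G.edgeChart e z) : ℂ)) (G.strip e) := fun _ hz _ hz' h =>
  G.injOn_edgeChart e hz hz' (u.φ_injective h)

/-- The flat coordinate around an open edge, as a function on the punctured disk. -/
theorem exists_edge_coordinate (e : Fin G.n) {x : ℝ} (hx : x ∈ interior (G.I e)) :
    ∃ ζ : ℂ → ℂ, AnalyticAt ℂ ζ (u.φ (G.edgeChart e x)) ∧
      ζ (u.φ (G.edgeChart e x)) = x ∧ ∀ᶠ w in 𝓝 (u.φ (G.edgeChart e x) : ℂ),
        u.inv w = G.edgeChart e (ζ w) := by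
  obtain ⟨ζ, h1, h2, h3⟩ := exists_analytic_localInverse (G.isOpen_strip e)
    (u.differentiableOn_edgeChart e) (u.injOn_φ_edgeChart e) (a := x) (by simpa [PlanarGluing.strip] using hx)
  refine ⟨ζ, h1, h2, h3.mono fun w hw => ?_⟩
  rw [← u.inv_φ (G.edgeChart e (ζ w)), hw.2]

/-- The images of the endpoints of the glued intervals. -/
def vertices : Set ℂ :=
  {w | ∃ e, ∃ x ∈ G.I e \ interior (G.I e), w = u.φ (G.pt (G.side e) (toHalfPlane x))}

theorem finite_vertices : u.vertices.Finite := by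
  have : u.vertices = ⋃ e, (fun x : ℝ => (u.φ (G.pt (G.side e) (toHalfPlane x)) : ℂ)) ''
      (G.I e \ interior (G.I e)) := by
    ext w
    simp only [vertices, Set.mem_ofPred_eq, Set.mem_iUnion, Set.mem_image, eq_comm]
  rw [this]
  exact Set.finite_iUnion fun e => (G.finite_frontier_I e).image _

/-- A boundary point in no glued interval lies on the boundary of the surface and maps to the unit
circle. Within the open disk only open half-planes, open edges and vertices occur. -/
theorem inv_cases {w : ℂ} (h0 : w ≠ 0) (h1 : ‖w‖ < 1) (hV : w ∉ u.vertices) :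
    (∃ j z, 0 < z.im ∧ u.inv w = G.pt j (toHalfPlane z)) ∨
      ∃ e, ∃ x : ℝ, x ∈ interior (G.I e) ∧ u.inv w = G.edgeChart e x := by
  obtain ⟨j, z, hz, h⟩ := G.exists_pt (u.inv w)
  rcases hz.lt_or_eq with hz | hz
  · exact Or.inl ⟨j, z, hz, h⟩
  · right
    obtain ⟨x, rfl⟩ : ∃ x : ℝ, (x : ℂ) = z := ⟨z.re, Complex.ext rfl (by simp [← hz])⟩
    have h2 : x ∉ closure {y : ℝ | ∀ e, G.side e = j → y ∉ G.I e} := fun h2 => by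
      have h3 := (u.norm_eq_one_iff (u.inv w)).2 ⟨j, x, h2, h⟩
      rw [u.φ_inv h0 h1.le] at h3
      exact h1.ne h3
    have h3 : ∃ e, G.side e = j ∧ x ∈ G.I e := by
      by_contra! h4
      exact h2 (subset_closure h4)
    obtain ⟨e, rfl, he⟩ := h3
    refine ⟨e, x, ?_, by rw [h, G.edgeChart_of_nonneg e (by simp)]⟩
    by_contra h4
    exact hV ⟨e, x, ⟨he, h4⟩, by rw [← h, u.φ_inv h0 h1.le]⟩

end Uniformization

end

/-! ### Logarithmic sheets, and why the two sides of a self-glued edge lie on different ones. -/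

noncomputable section

/-- A larger value at `s` would, by the intermediate value theorem, force the value `v t` on both
sides of `s`; both preimages are `t`, so `s = t`. -/
theorem le_of_simple_value {v : ℝ → ℝ} (hv : Continuous v) {x y t : ℝ} (hxy : v x = v y)
    (ht : ∀ s ∈ Set.Icc x y, v s = v t → s = t) (hlt : v x < v t) :
    ∀ s ∈ Set.Icc x y, v s ≤ v t := by
  intro s hs
  by_contra! h
  obtain ⟨a, ha, ha'⟩ := intermediate_value_Icc hs.1 hv.continuousOn ⟨hlt.le, h.le⟩
  obtain ⟨b, hb, hb'⟩ := intermediate_value_Icc' hs.2 hv.continuousOn ⟨(hxy ▸ hlt).le, h.le⟩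
  have h1 := ht a ⟨ha.1, ha.2.trans hs.2⟩ ha'
  have h2 := ht b ⟨hs.1.trans hb.1, hb.2⟩ hb'
  have : s = t := le_antisymm (h2 ▸ hb.1) (h1 ▸ ha.2)
  rw [this] at h
  exact lt_irrefl _ h

/-- A continuous function on an interval with equal values at the endpoints takes at most two
values exactly once. -/
theorem not_three_simple_values {v : ℝ → ℝ} (hv : Continuous v) {x y : ℝ} (hxy : v x = v y)
    (D : Set ℝ) (hD : Dense D) (hlt : x < y)
    (h : ∀ t ∈ D, t ∈ Set.Ioo x y → ∀ s ∈ Set.Icc x y, v s = v t → s = t) : False := by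
  have key : ∀ t ∈ D, t ∈ Set.Ioo x y →
      (∀ s ∈ Set.Icc x y, v s ≤ v t) ∨ (∀ s ∈ Set.Icc x y, v t ≤ v s) := by
    intro t htD ht
    rcases lt_trichotomy (v x) (v t) with h1 | h1 | h1
    · exact Or.inl (le_of_simple_value hv hxy (h t htD ht) h1)
    · exact absurd (h t htD ht x ⟨le_rfl, hlt.le⟩ h1) ht.1.ne
    · refine Or.inr fun s hs => ?_
      have := le_of_simple_value (v := fun s => - v s) hv.neg (by simpa using hxy)
        (fun s hs h2 => h t htD ht s hs (neg_inj.1 h2)) (by simpa using h1) s hs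
      simpa using this
  have two : ∀ a ∈ D, ∀ b ∈ D, a ∈ Set.Ioo x y → b ∈ Set.Ioo x y → a < b →
      ¬ ((∀ s ∈ Set.Icc x y, v s ≤ v a) ∧ (∀ s ∈ Set.Icc x y, v s ≤ v b)) ∧
      ¬ ((∀ s ∈ Set.Icc x y, v a ≤ v s) ∧ (∀ s ∈ Set.Icc x y, v b ≤ v s)) := by
    intro a ha b hb ha' hb' hab
    have ha2 := Set.Ioo_subset_Icc_self ha'
    have hb2 := Set.Ioo_subset_Icc_self hb'
    constructor
    · rintro ⟨h1, h2⟩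
      exact hab.ne (h b hb hb' a ha2 (le_antisymm (h2 a ha2) (h1 b hb2)))
    · rintro ⟨h1, h2⟩
      exact hab.ne (h b hb hb' a ha2 (le_antisymm (h1 b hb2) (h2 a ha2)))
  -- Each simple value is a maximum or a minimum, and each of these is attained at most once among
  -- simple points, so three points are too many.
  obtain ⟨a, haD, ha⟩ := hD.exists_between hlt
  obtain ⟨b, hbD, hb⟩ := hD.exists_between ha.2
  obtain ⟨c, hcD, hc⟩ := hD.exists_between hb.2
  have hb' : b ∈ Set.Ioo x y := ⟨ha.1.trans hb.1, hb.2⟩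
  have hc' : c ∈ Set.Ioo x y := ⟨hb'.1.trans hc.1, hc.2⟩
  have h1 := two a haD b hbD ha hb' hb.1
  have h2 := two b hbD c hcD hb' hc' hc.1
  have h3 := two a haD c hcD ha hc' (hb.1.trans hc.1)
  rcases key a haD ha with ka | ka <;> rcases key b hbD hb' with kb | kb <;>
    rcases key c hcD hc' with kc | kc <;> tauto

namespace Uniformization

variable {k : ℕ} {G : PlanarGluing k} {θ : ℝ} (u : Uniformization G θ)

/-- `L` is a continuous logarithm of the uniformization on the `j`-th half-plane. -/
def IsLog (j : ZMod k) (L : ℂ → ℂ) : Prop :=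
  Continuous L ∧ ∀ z, Complex.exp (L z) = u.φ (G.pt j (toHalfPlane z))

theorem exists_isLog (j : ZMod k) : ∃ L, u.IsLog j L :=
  exists_continuous_log _ (u.continuous_φ_pt j) fun z => (u.φ (G.pt j (toHalfPlane z))).2.1

variable {u}

theorem IsLog.pt_eq {i j : ZMod k} {L M : ℂ → ℂ} (hL : u.IsLog j L) (hM : u.IsLog i M) {z z' : ℂ}
    (h : L z = M z') : G.pt j (toHalfPlane z) = G.pt i (toHalfPlane z') :=
  u.φ_injective (by rw [← hL.2, ← hM.2, h])

theorem IsLog.add {j : ZMod k} {L : ℂ → ℂ} (hL : u.IsLog j L) {c : ℂ} (hc : Complex.exp c = 1) :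
    u.IsLog j fun z => L z + c :=
  ⟨hL.1.add continuous_const, fun z => by rw [Complex.exp_add, hc, mul_one, hL.2]⟩

/-- The ray ends at the puncture, where `Re L = log ‖φ‖` tends to `-∞`. The parameter `τ ^ 2` keeps
the path in the open half-plane for all real `τ`. -/
theorem IsLog.tendsto_norm {j : ZMod k} {L : ℂ → ℂ} (hL : u.IsLog j L) {a : ℂ} (ha : 0 < a.im) :
    Tendsto (fun τ : ℝ => ‖L (a + (τ ^ 2 : ℝ) * Complex.I)‖) atTop atTop := by
  have h1 : Tendsto (fun τ : ℝ => toHalfPlane (a + (τ ^ 2 : ℝ) * Complex.I)) atTop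
      (cocompact ClosedHalfPlane) := by
    refine Tendsto.mono_right ?_ (comap_cocompact_le (continuous_subtype_val))
    rw [tendsto_comap_iff, ← Metric.cobounded_eq_cocompact, ← comap_norm_atTop, tendsto_comap_iff]
    have h2 : Tendsto (fun τ : ℝ => τ ^ 2) atTop atTop := tendsto_pow_atTop two_ne_zero
    refine tendsto_atTop_mono (fun τ => ?_) h2
    have h3 : 0 ≤ (a + (τ ^ 2 : ℝ) * Complex.I).im := by
      have := add_nonneg ha.le (sq_nonneg τ)
      simpa [← Complex.ofReal_pow] using this
    simp only [Function.comp, coe_toHalfPlane h3]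
    refine le_trans ?_ ((le_abs_self _).trans (Complex.abs_im_le_norm _))
    simp only [Complex.add_im, Complex.mul_im, Complex.ofReal_re, Complex.I_im, Complex.ofReal_im,
      Complex.I_re]
    linarith
  have h2 := ((u.tendsto_puncture j).comp h1).norm
  rw [norm_zero] at h2
  have h3 : Tendsto (fun τ : ℝ => ‖(u.φ (G.pt j (toHalfPlane (a + (τ ^ 2 : ℝ) * Complex.I))) : ℂ)‖)
      atTop (𝓝[>] 0) :=
    tendsto_nhdsWithin_iff.2 ⟨h2, Eventually.of_forall fun τ => norm_pos_iff.2 (u.φ _).2.1⟩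
  refine tendsto_atTop_mono (fun τ => ?_) (tendsto_neg_atBot_atTop.comp (Real.tendsto_log_nhdsGT_zero.comp h3))
  simp only [Function.comp, ← hL.2, Complex.norm_exp, Real.log_exp]
  exact (neg_le_abs _).trans (Complex.abs_re_le_norm _)

/-- The image of a segment of the boundary of a half-plane that is closed up in the logarithmic
plane has winding number zero about the points of the open half-planes. -/
theorem IsLog.exists_closed_log_sub {i j : ZMod k} {L M : ℂ → ℂ} (hL : u.IsLog j L)
    (hM : u.IsLog i M) {x y : ℝ} (hxy : x ≤ y) (hcl : L x = L y) {a : ℂ} (ha : 0 < a.im) :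
    ∃ A : ℝ → ℂ, Continuous A ∧ (∀ s : ℝ, Complex.exp (A s) = L s - M a) ∧ A x = A y := by
  have := _root_.exists_closed_log_sub (l := fun s : ℝ => L s) (hL.1.comp Complex.continuous_ofReal)
    (q := fun τ : ℝ => M (a + (τ ^ 2 : ℝ) * Complex.I)) (hM.1.comp (by fun_prop)) ?_
    (hM.tendsto_norm ha) hxy hcl
  · simpa using this
  · intro s τ h
    have h1 : 0 < (a + (τ ^ 2 : ℝ) * Complex.I).im := by
      have := add_pos_of_pos_of_nonneg ha (sq_nonneg τ)
      simpa [← Complex.ofReal_pow] using this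
    have h2 := (G.pt_eq_of_im_pos h1 (by simp) (hM.pt_eq hL h.symm)).2
    rw [← h2] at h1
    simp at h1

/-- If a half-plane is glued to itself along an edge, then the two sides of the edge lie on
different sheets of the logarithm: the loop from one side to the other goes around the puncture. -/
theorem IsLog.ne_of_fold {e : Fin G.n} (hs : G.side (G.rev e) = G.side e) {L : ℂ → ℂ}
    (hL : u.IsLog (G.side e) L) {x : ℝ} (hx : x ∈ G.I e) : L x ≠ L ((G.shift e : ℂ) - x) := by
  intro hxe
  set j := G.side e with hj
  set S : Fin G.n → Set ℝ := fun f => {y | y ∈ G.I f ∧ L y = L ((G.shift f : ℂ) - y)} with hS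
  have hSc : ∀ f, IsClosed (S f) := fun f => (G.isClosed_I f).inter
    (isClosed_eq (hL.1.comp (by fun_prop)) (hL.1.comp (by fun_prop)))
  -- a pair of points at minimal distance
  obtain ⟨f, x₀, hf, hf', hx₀, hmin⟩ : ∃ f x₀, G.side f = j ∧ G.side (G.rev f) = j ∧ x₀ ∈ S f ∧
      ∀ g y, G.side g = j → G.side (G.rev g) = j → y ∈ S g →
        |G.shift f / 2 - x₀| ≤ |G.shift g / 2 - y| := by
    obtain ⟨f, ⟨hf1, hf2, hf3⟩, hfm⟩ := Set.exists_min_image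
      {f | G.side f = j ∧ G.side (G.rev f) = j ∧ (S f).Nonempty}
      (fun f => Metric.infDist (G.shift f / 2) (S f)) (Set.toFinite _) ⟨e, rfl, hs, x, hx, hxe⟩
    obtain ⟨x₀, hx₀, hd⟩ := (hSc f).exists_infDist_eq_dist hf3 (G.shift f / 2)
    refine ⟨f, x₀, hf1, hf2, hx₀, fun g y h1 h2 h3 => ?_⟩
    rw [← Real.dist_eq, ← Real.dist_eq, ← hd]
    exact (hfm g ⟨h1, h2, ⟨y, h3⟩⟩).trans (Metric.infDist_le_dist_of_mem h3)
  obtain ⟨x, y, hlt, hcl, hmin⟩ : ∃ x y : ℝ, x < y ∧ L x = L y ∧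
      ∀ g t, G.side g = j → G.side (G.rev g) = j → t ∈ S g → y - x ≤ |G.shift g - t - t| := by
    have h2 : ∀ g t, G.side g = j → G.side (G.rev g) = j → t ∈ S g →
        |G.shift f - x₀ - x₀| ≤ |G.shift g - t - t| := by
      intro g t h1 h2 h3
      have h4 := hmin g t h1 h2 h3
      have h5 : ∀ c s : ℝ, |c - s - s| = 2 * |c / 2 - s| := fun c s => by
        rw [← abs_two (α := ℝ), ← abs_mul, abs_two]; congr 1; ring
      rw [h5, h5]; linarith
    -- The absence of folds makes the minimal pair two distinct points, so the innermost segment is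
    -- nondegenerate.
    rcases lt_or_gt_of_ne (G.no_fold f (hf'.trans hf.symm) x₀ hx₀.1) with h | h
    · refine ⟨G.shift f - x₀, x₀, h, by simpa using hx₀.2.symm, fun g t h3 h4 h5 => ?_⟩
      have := h2 g t h3 h4 h5
      rw [abs_of_neg (by linarith : G.shift f - x₀ - x₀ < 0)] at this
      linarith
    · refine ⟨x₀, G.shift f - x₀, h, by simpa using hx₀.2, fun g t h3 h4 h5 => ?_⟩
      have := h2 g t h3 h4 h5
      rw [abs_of_pos (by linarith : 0 < G.shift f - x₀ - x₀)] at this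
      linarith
  have hno : ∀ g t, G.side g = j → G.side (G.rev g) = j → t ∈ G.I g → t ∈ Set.Ioo x y →
      G.shift g - t ∈ Set.Icc x y → L t ≠ L ((G.shift g : ℂ) - t) := by
    intro g t h1 h2 h3 h4 h5 h6
    have := hmin g t h1 h2 ⟨h3, h6⟩
    have h7 : |G.shift g - t - t| < y - x :=
      abs_lt.2 ⟨by linarith [h4.2, h5.1], by linarith [h4.1, h5.2]⟩
    linarith
  -- Either the segment contains an interior point of an edge, where the winding number argument
  -- applies, or it is unglued apart from finitely many endpoints.
  by_cases hcase : ∃ t ∈ Set.Ioo x y, ∃ g, G.side g = j ∧ t ∈ interior (G.I g)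
  · obtain ⟨t, ht, g, hg, htg⟩ := hcase
    set E : ℂ → ℂ := fun z => (u.φ (G.edgeChart g z) : ℂ) with hE
    have htS : (t : ℂ) ∈ G.strip g := by simpa [PlanarGluing.strip] using htg
    have hEa : AnalyticAt ℂ E t :=
      (u.differentiableOn_edgeChart g).analyticAt ((G.isOpen_strip g).mem_nhds htS)
    have hEd : deriv E t ≠ 0 := deriv_ne_zero_of_injOn (G.isOpen_strip g)
      (u.differentiableOn_edgeChart g) (u.injOn_φ_edgeChart g) htS
    have hE0 : ∀ z, E z ≠ 0 := fun z => (u.φ _).2.1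
    have hEL : ∀ z : ℂ, 0 ≤ z.im → E z = Complex.exp (L z) := fun z hz => by
      rw [hL.2, hE]; simp only [G.edgeChart_of_nonneg g hz, hg]
    -- The continuation of `L` across the edge: an analytic logarithm of the edge chart that agrees
    -- with `L` on the upper side near `t`.
    set Λ : ℂ → ℂ := fun z => Complex.log (E z / E t) + L t with hΛ
    have hslit : E t / E t ∈ Complex.slitPlane := by
      rw [div_self (hE0 t)]; exact Complex.one_mem_slitPlane
    have hΛa : AnalyticAt ℂ Λ t := ((hEa.div analyticAt_const (hE0 t)).clog hslit).add analyticAt_const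
    have hΛd : deriv Λ t ≠ 0 := by
      have h1 : HasDerivAt Λ (deriv E t / E t / (E t / E t)) t :=
        ((hEa.differentiableAt.hasDerivAt.div_const (E t)).clog hslit).add_const (L t)
      rw [h1.deriv, div_self (hE0 t), div_one]
      exact div_ne_zero hEd (hE0 t)
    have hΛL : ∀ᶠ z in 𝓝 (t : ℂ), 0 ≤ z.im → Λ z = L z := by
      have h1 : ∀ᶠ z in 𝓝 (t : ℂ), ‖L z - L t‖ < 1 := by
        have := (hL.1.tendsto (t : ℂ)).eventually (Metric.ball_mem_nhds _ one_pos)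
        simpa [dist_eq_norm] using this
      filter_upwards [h1] with z hz him
      have h2 := (Complex.abs_im_le_norm (L z - L t)).trans_lt hz
      have hπ := Real.pi_gt_three
      rw [abs_lt] at h2
      simp only [hΛ]
      rw [hEL z him, hEL t (by simp), ← Complex.exp_sub, Complex.log_exp (by linarith) (by linarith)]
      ring
    have hΛE : ∀ z, Complex.exp (Λ z) = E z := by
      intro z
      simp only [hΛ]
      rw [Complex.exp_add, Complex.exp_log (div_ne_zero (hE0 z) (hE0 t)), ← hEL t (by simp),
        div_mul_cancel₀ _ (hE0 t)]
    refine winding_not_zero_on_both_sides (l := fun s : ℝ => L s) (hL.1.comp Complex.continuous_ofReal)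
      ht.1 ht.2 hcl ?_ hΛa hΛd ?_ ?_ ?_
    · intro s hs hst
      have h1 := hL.pt_eq hL hst.symm
      rw [← hg] at h1
      rcases G.pt_eq_of_mem_interior htg (by simp) h1 with h2 | h2
      · exact_mod_cast h2.2
      · exfalso
        have h3 : s = G.shift g - t := by exact_mod_cast h2.2
        refine hno g t hg (h2.1 ▸ hg) (interior_subset htg) ht (h3 ▸ hs) ?_
        rw [← h2.2]; exact hst.symm
    · have := Complex.continuous_ofReal.tendsto t hΛL
      filter_upwards [this] with s hs using hs (by simp)
    · have hc : Tendsto (fun η : ℝ => (t : ℂ) + η * Complex.I) (𝓝 0) (𝓝 t) := by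
        have : Continuous (fun η : ℝ => (t : ℂ) + η * Complex.I) := by fun_prop
        simpa using this.tendsto 0
      filter_upwards [nhdsWithin_le_nhds (hc hΛL), self_mem_nhdsWithin] with η h1 h2
      have h2 : 0 < η := h2
      rw [h1 (by simpa using h2.le)]
      exact hL.exists_closed_log_sub hL hlt.le hcl (by simpa using h2)
    · filter_upwards [self_mem_nhdsWithin] with η h2
      have h2 : 0 < η := h2
      -- Below the edge lies the half-plane of `rev g`. A logarithm there, moved to the sheet of `Λ`
      -- by a period depending on `η`, supplies the escape path.
      obtain ⟨M, hM⟩ := u.exists_isLog (G.side (G.rev g))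
      set a : ℂ := (G.shift g : ℂ) - (t - η * Complex.I) with ha
      have ha0 : 0 < a.im := by simpa [ha] using h2
      have h3 : Complex.exp (Λ (t - η * Complex.I) - M a) = 1 := by
        rw [Complex.exp_sub, hΛE, hM.2, hE]
        simp only [G.edgeChart_of_neg g (z := t - η * Complex.I) (by simpa using h2)]
        exact div_self (u.φ _).2.1
      have := hL.exists_closed_log_sub (hM.add h3) hlt.le hcl ha0
      simpa using this
  · push Not at hcase
    set F : Set ℝ := ⋃ g, (G.I g \ interior (G.I g)) with hF
    have hFf : F.Finite := Set.finite_iUnion fun g => G.finite_frontier_I g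
    have hFd : Dense Fᶜ := hFf.countable.dense_compl ℝ
    have hun : ∀ t ∈ Fᶜ, t ∈ Set.Ioo x y → ∀ g, G.side g = j → t ∉ G.I g := by
      intro t htF ht g hg htg
      exact htF (Set.mem_iUnion.2 ⟨g, htg, hcase t ht g hg⟩)
    -- The unglued segment maps to the unit circle, so its logarithm runs in the imaginary axis and
    -- `Im L` is a real function with equal end values.
    have hre : ∀ t ∈ Set.Icc x y, (L t).re = 0 := by
      intro t ht
      have h1 : t ∈ closure {y : ℝ | ∀ e, G.side e = j → y ∉ G.I e} := by
        rw [← closure_Ioo hlt.ne] at ht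
        refine closure_minimal ?_ isClosed_closure ht
        refine (hFd.open_subset_closure_inter isOpen_Ioo).trans (closure_mono ?_)
        rintro s ⟨h2, h3⟩
        exact hun s h3 h2
      have h2 := (u.norm_eq_one_iff _).2 ⟨j, t, h1, rfl⟩
      rwa [← hL.2, Complex.norm_exp, Real.exp_eq_one_iff] at h2
    refine not_three_simple_values (v := fun s : ℝ => (L s).im)
      (Complex.continuous_im.comp (hL.1.comp Complex.continuous_ofReal)) (congrArg Complex.im hcl) Fᶜ hFd
      hlt fun t htF ht s hs hst => ?_
    have h1 : L t = L s :=
      Complex.ext (by rw [hre t (Set.Ioo_subset_Icc_self ht), hre s hs]) hst.symm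
    have h2 := G.pt_eq_of_unglued (hun t htF ht) (by simp) (hL.pt_eq hL h1)
    exact_mod_cast h2.2

end Uniformization

end

noncomputable section

/-! ### The distance of two planar ends, measured on the sheets of the logarithm -/

section Sheets

variable {k : ℕ} {G₁ G₂ : PlanarGluing k}

/-- Two points of the open half-planes with the same label, on the same sheet of the logarithm. -/
def SameSheet (L₁ L₂ : ZMod k → ℂ → ℂ) (p : G₁.Surface) (q : G₂.Surface) : Prop :=
  ∃ j z z', 0 < z.im ∧ 0 < z'.im ∧ p = G₁.pt j (toHalfPlane z) ∧ q = G₂.pt j (toHalfPlane z') ∧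
    L₁ j z = L₂ j z'

theorem SameSheet.symm {L₁ L₂ : ZMod k → ℂ → ℂ} {p : G₁.Surface} {q : G₂.Surface}
    (h : SameSheet L₁ L₂ p q) : SameSheet L₂ L₁ q p := by
  obtain ⟨j, z, z', h1, h2, h3, h4, h5⟩ := h
  exact ⟨j, z', z, h2, h1, h4, h3, h5.symm⟩

theorem sameSheet_pt_iff {L₁ L₂ : ZMod k → ℂ → ℂ} {i j : ZMod k} {z z' : ℂ} (hz : 0 < z.im)
    (hz' : 0 < z'.im) : SameSheet L₁ L₂ (G₁.pt j (toHalfPlane z)) (G₂.pt i (toHalfPlane z')) ↔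
      j = i ∧ L₁ j z = L₂ i z' := by
  constructor
  · rintro ⟨l, a, b, ha, hb, h1, h2, h3⟩
    obtain ⟨rfl, rfl⟩ := G₁.pt_eq_of_im_pos hz ha.le h1
    obtain ⟨h4, rfl⟩ := G₂.pt_eq_of_im_pos hz' hb.le h2
    subst h4
    exact ⟨rfl, h3⟩
  · rintro ⟨rfl, h⟩
    exact ⟨j, z, z', hz, hz', rfl, rfl, h⟩

open Classical in
/-- The distance of two points in the tree that has one prong for each sheet of each half-plane. -/
def sheetDist (L₁ L₂ : ZMod k → ℂ → ℂ) (p : G₁.Surface) (q : G₂.Surface) : ℝ :=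
  if SameSheet L₁ L₂ p q then |G₁.height p - G₂.height q| else G₁.height p + G₂.height q

variable (L₁ L₂ : ZMod k → ℂ → ℂ) (p : G₁.Surface) (q : G₂.Surface)

theorem sheetDist_comm : sheetDist L₁ L₂ p q = sheetDist L₂ L₁ q p := by
  have : SameSheet L₁ L₂ p q ↔ SameSheet L₂ L₁ q p := ⟨SameSheet.symm, SameSheet.symm⟩
  by_cases h : SameSheet L₁ L₂ p q
  · rw [sheetDist, sheetDist, if_pos h, if_pos h.symm, abs_sub_comm]
  · rw [sheetDist, sheetDist, if_neg h, if_neg (this.not.1 h), add_comm]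

variable {L₁ L₂ p q} in
theorem sheetDist_of_same (h : SameSheet L₁ L₂ p q) :
    sheetDist L₁ L₂ p q = |G₁.height p - G₂.height q| := if_pos h

variable {L₁ L₂ p q} in
theorem sheetDist_of_not_same (h : ¬ SameSheet L₁ L₂ p q) :
    sheetDist L₁ L₂ p q = G₁.height p + G₂.height q := if_neg h

theorem abs_height_sub_le_add : |G₁.height p - G₂.height q| ≤ G₁.height p + G₂.height q := by
  have h1 := G₁.height_nonneg p
  have h2 := G₂.height_nonneg q
  exact abs_le.2 ⟨by linarith, by linarith⟩

theorem abs_height_sub_le_sheetDist : |G₁.height p - G₂.height q| ≤ sheetDist L₁ L₂ p q := by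
  by_cases h : SameSheet L₁ L₂ p q
  · rw [sheetDist_of_same h]
  · rw [sheetDist_of_not_same h]; exact abs_height_sub_le_add p q

theorem sheetDist_le : sheetDist L₁ L₂ p q ≤ G₁.height p + G₂.height q := by
  by_cases h : SameSheet L₁ L₂ p q
  · rw [sheetDist_of_same h]; exact abs_height_sub_le_add p q
  · rw [sheetDist_of_not_same h]

theorem dist_collapse_le_add [NeZero k] :
    dist (G₁.collapse p) (G₂.collapse q) ≤ G₁.height p + G₂.height q := by
  have h0 := abs_height_sub_le_add p q
  obtain ⟨j, z, hz, rfl⟩ := G₁.exists_pt p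
  obtain ⟨i, z', hz', rfl⟩ := G₂.exists_pt q
  rw [G₁.height_pt j hz, G₂.height_pt i hz'] at *
  rw [G₁.collapse_pt j hz, G₂.collapse_pt i hz']
  by_cases h : j = i
  · subst h; rwa [dist_prong_same]
  · rw [dist_prong_ne _ _ h]

theorem abs_height_sub_le_dist_collapse [NeZero k] :
    |G₁.height p - G₂.height q| ≤ dist (G₁.collapse p) (G₂.collapse q) := by
  have h0 := abs_height_sub_le_add p q
  obtain ⟨j, z, hz, rfl⟩ := G₁.exists_pt p
  obtain ⟨i, z', hz', rfl⟩ := G₂.exists_pt q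
  rw [G₁.height_pt j hz, G₂.height_pt i hz'] at *
  rw [G₁.collapse_pt j hz, G₂.collapse_pt i hz']
  by_cases h : j = i
  · subst h; rw [dist_prong_same]
  · rwa [dist_prong_ne _ _ h]

/-- Forgetting the sheet but keeping the label of the half-plane does not increase distances. -/
theorem dist_collapse_le_sheetDist [NeZero k] :
    dist (G₁.collapse p) (G₂.collapse q) ≤ sheetDist L₁ L₂ p q := by
  by_cases h : SameSheet L₁ L₂ p q
  · rw [sheetDist_of_same h]
    obtain ⟨j, z, z', hz, hz', rfl, rfl, -⟩ := h
    rw [G₁.height_pt j hz.le, G₂.height_pt j hz'.le, G₁.collapse_pt j hz.le,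
      G₂.collapse_pt j hz'.le, dist_prong_same]
  · rw [sheetDist_of_not_same h]; exact dist_collapse_le_add p q

end Sheets

/-! ### Continuity and local harmonic minorants of the sheet distance. -/

namespace Uniformization

theorem exists_coordinate_of_height_pos {k : ℕ} {G : PlanarGluing k} {θ : ℝ}
    (u : Uniformization G θ) {a : ℂ} (h0 : a ≠ 0) (h1 : ‖a‖ ≤ 1) (h : 0 < G.height (u.inv a)) :
    ∃ (j : ZMod k) (ζ : ℂ → ℂ), AnalyticAt ℂ ζ a ∧
      ∀ᶠ w in 𝓝 a, 0 < (ζ w).im ∧ u.inv w = G.pt j (toHalfPlane (ζ w)) := by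
  obtain ⟨j, z, hz, hp⟩ := G.exists_pt (u.inv a)
  rw [hp, G.height_pt j hz] at h
  obtain ⟨ζ, h2, -, h3⟩ := u.exists_halfPlane_coordinate j h
  rw [← hp, u.φ_inv h0 h1] at h2 h3
  exact ⟨j, ζ, h2, h3⟩

variable {k : ℕ} {G₁ G₂ : PlanarGluing k} {θ₁ θ₂ : ℝ} {u₁ : Uniformization G₁ θ₁}
  {u₂ : Uniformization G₂ θ₂} {L₁ L₂ : ZMod k → ℂ → ℂ}

/-- In local coordinates the difference of the two logarithms is continuous with values in `2πiℤ`,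
hence locally constant. The conditions on `w` are needed because `inv` is a dummy constant
elsewhere. -/
theorem eventually_sameSheet_iff (hL₁ : ∀ j, u₁.IsLog j (L₁ j)) (hL₂ : ∀ j, u₂.IsLog j (L₂ j))
    {a : ℂ} (h0 : a ≠ 0) (h1 : ‖a‖ ≤ 1) (hp : 0 < G₁.height (u₁.inv a))
    (hq : 0 < G₂.height (u₂.inv a)) :
    ∀ᶠ w in 𝓝 a, w ≠ 0 → ‖w‖ ≤ 1 →
      (SameSheet L₁ L₂ (u₁.inv w) (u₂.inv w) ↔ SameSheet L₁ L₂ (u₁.inv a) (u₂.inv a)) := by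
  obtain ⟨j, ζ₁, hζ₁, he₁⟩ := u₁.exists_coordinate_of_height_pos h0 h1 hp
  obtain ⟨i, ζ₂, hζ₂, he₂⟩ := u₂.exists_coordinate_of_height_pos h0 h1 hq
  have ha₁ := he₁.self_of_nhds
  have ha₂ := he₂.self_of_nhds
  rw [ha₁.2, ha₂.2, sameSheet_pt_iff ha₁.1 ha₂.1]
  have hc : ContinuousAt (fun w => L₁ j (ζ₁ w) - L₂ i (ζ₂ w)) a :=
    ((hL₁ j).1.continuousAt.comp hζ₁.continuousAt).sub
      ((hL₂ i).1.continuousAt.comp hζ₂.continuousAt)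
  have hexp : ∀ᶠ w in 𝓝 a, w ≠ 0 → ‖w‖ ≤ 1 → Complex.exp (L₁ j (ζ₁ w) - L₂ i (ζ₂ w)) = 1 := by
    filter_upwards [he₁, he₂] with w h2 h3 h4 h5
    rw [Complex.exp_sub, (hL₁ j).2, (hL₂ i).2, ← h2.2, ← h3.2, u₁.φ_inv h4 h5, u₂.φ_inv h4 h5,
      div_self h4]
  have hconst : ∀ᶠ w in 𝓝 a, w ≠ 0 → ‖w‖ ≤ 1 →
      (L₁ j (ζ₁ w) = L₂ i (ζ₂ w) ↔ L₁ j (ζ₁ a) = L₂ i (ζ₂ a)) := by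
    have h2 := hexp.self_of_nhds h0 h1
    filter_upwards [hexp, hc.eventually (Metric.ball_mem_nhds _ one_pos)] with w h3 h4 h5 h6
    have h7 := eq_zero_of_exp_eq_one_of_norm_lt
      (z := L₁ j (ζ₁ w) - L₂ i (ζ₂ w) - (L₁ j (ζ₁ a) - L₂ i (ζ₂ a)))
      (by rw [Complex.exp_sub, h3 h5 h6, h2, div_one]) (by rwa [dist_eq_norm] at h4)
    rw [← sub_eq_zero, sub_eq_zero.1 h7, sub_eq_zero]
  filter_upwards [he₁, he₂, hconst] with w h2 h3 h4 h5 h6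
  rw [h2.2, h3.2, sameSheet_pt_iff h2.1 h3.1, h4 h5 h6]

/-- At positive heights the sheet relation is locally constant. Where a height vanishes, the
relation may change, but the bounds `|h₁ - h₂|` and `h₁ + h₂` coincide there and squeeze. -/
theorem continuousOn_sheetDist (hL₁ : ∀ j, u₁.IsLog j (L₁ j)) (hL₂ : ∀ j, u₂.IsLog j (L₂ j)) :
    ContinuousOn (fun w => sheetDist L₁ L₂ (u₁.inv w) (u₂.inv w)) {w : ℂ | w ≠ 0 ∧ ‖w‖ ≤ 1} := by
  intro a ha
  have hc₁ : ContinuousWithinAt (fun w => G₁.height (u₁.inv w)) {w : ℂ | w ≠ 0 ∧ ‖w‖ ≤ 1} a :=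
    G₁.continuous_height.continuousAt.comp_continuousWithinAt (u₁.continuousOn_inv a ha)
  have hc₂ : ContinuousWithinAt (fun w => G₂.height (u₂.inv w)) {w : ℂ | w ≠ 0 ∧ ‖w‖ ≤ 1} a :=
    G₂.continuous_height.continuousAt.comp_continuousWithinAt (u₂.continuousOn_inv a ha)
  have hn₁ := G₁.height_nonneg (u₁.inv a)
  have hn₂ := G₂.height_nonneg (u₂.inv a)
  by_cases h : 0 < G₁.height (u₁.inv a) ∧ 0 < G₂.height (u₂.inv a)
  · have hs : ∀ᶠ w in 𝓝[{w : ℂ | w ≠ 0 ∧ ‖w‖ ≤ 1}] a,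
        (SameSheet L₁ L₂ (u₁.inv w) (u₂.inv w) ↔ SameSheet L₁ L₂ (u₁.inv a) (u₂.inv a)) := by
      filter_upwards [nhdsWithin_le_nhds (eventually_sameSheet_iff hL₁ hL₂ ha.1 ha.2 h.1 h.2),
        self_mem_nhdsWithin] with w h1 h2 using h1 h2.1 h2.2
    by_cases h3 : SameSheet L₁ L₂ (u₁.inv a) (u₂.inv a)
    · refine (hc₁.sub hc₂).abs.congr_of_eventuallyEq ?_ (sheetDist_of_same h3)
      filter_upwards [hs] with w hw using sheetDist_of_same (hw.2 h3)
    · refine (hc₁.add hc₂).congr_of_eventuallyEq ?_ (sheetDist_of_not_same h3)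
      filter_upwards [hs] with w hw using sheetDist_of_not_same fun h4 => h3 (hw.1 h4)
  · have heq : |G₁.height (u₁.inv a) - G₂.height (u₂.inv a)| =
        G₁.height (u₁.inv a) + G₂.height (u₂.inv a) := by
      by_cases h1 : 0 < G₁.height (u₁.inv a)
      · have h2 : G₂.height (u₂.inv a) = 0 := le_antisymm (not_lt.1 fun h2 => h ⟨h1, h2⟩) hn₂
        rw [h2, sub_zero, add_zero, abs_of_nonneg hn₁]
      · have h2 : G₁.height (u₁.inv a) = 0 := le_antisymm (not_lt.1 h1) hn₁
        rw [h2, zero_sub, zero_add, abs_neg, abs_of_nonneg hn₂]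
    have hval : sheetDist L₁ L₂ (u₁.inv a) (u₂.inv a) =
        G₁.height (u₁.inv a) + G₂.height (u₂.inv a) :=
      le_antisymm (sheetDist_le _ _ _ _) (heq ▸ abs_height_sub_le_sheetDist _ _ _ _)
    have hlow : Tendsto (fun w => |G₁.height (u₁.inv w) - G₂.height (u₂.inv w)|)
        (𝓝[{w : ℂ | w ≠ 0 ∧ ‖w‖ ≤ 1}] a) (𝓝 (G₁.height (u₁.inv a) + G₂.height (u₂.inv a))) := by
      rw [← heq]; exact (hc₁.sub hc₂).abs
    have hupp := (hc₁.add hc₂).tendsto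
    rw [ContinuousWithinAt, hval]
    exact tendsto_of_tendsto_of_tendsto_of_le_of_le hlow hupp
      (fun w => abs_height_sub_le_sheetDist _ _ _ _) (fun w => sheetDist_le _ _ _ _)

/-- The function `sheetDist` has harmonic local minorants at the points of an open edge of the first
surface. -/
theorem exists_minorant_of_edge (hL₁ : ∀ j, u₁.IsLog j (L₁ j)) (hL₂ : ∀ j, u₂.IsLog j (L₂ j))
    {a : ℂ} (h0 : a ≠ 0) (h1 : ‖a‖ ≤ 1) {e : Fin G₁.n} {x : ℝ} (hx : x ∈ interior (G₁.I e))
    (hp : u₁.inv a = G₁.edgeChart e x) (hq : 0 < G₂.height (u₂.inv a)) :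
    ∃ g : ℂ → ℂ, AnalyticAt ℂ g a ∧ (g a).re = sheetDist L₁ L₂ (u₁.inv a) (u₂.inv a) ∧
      ∀ᶠ w in 𝓝 a, (g w).re ≤ sheetDist L₁ L₂ (u₁.inv w) (u₂.inv w) := by
  obtain ⟨ζ₁, hζ₁, hxa, he₁⟩ := u₁.exists_edge_coordinate e hx
  rw [← hp, u₁.φ_inv h0 h1] at hζ₁ hxa he₁
  obtain ⟨j, ζ₂, hζ₂, he₂⟩ := u₂.exists_coordinate_of_height_pos h0 h1 hq
  have ha₂ := he₂.self_of_nhds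
  have hh₁ : G₁.height (u₁.inv a) = 0 := by rw [hp, G₁.height_edgeChart]; simp
  have hh₂ : G₂.height (u₂.inv a) = (ζ₂ a).im := by rw [ha₂.2, G₂.height_pt j ha₂.1.le]
  have hval : sheetDist L₁ L₂ (u₁.inv a) (u₂.inv a) = (ζ₂ a).im := by
    have h2 := abs_height_sub_le_sheetDist L₁ L₂ (u₁.inv a) (u₂.inv a)
    have h3 := sheetDist_le L₁ L₂ (u₁.inv a) (u₂.inv a)
    rw [hh₁, hh₂, zero_sub, abs_neg, abs_of_pos ha₂.1] at h2
    rw [hh₁, hh₂, zero_add] at h3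
    exact le_antisymm h3 h2
  -- the minorants on the side where the sheets may agree
  have hlow : ∀ᶠ w in 𝓝 a,
      (ζ₂ w).im - |(ζ₁ w).im| ≤ sheetDist L₁ L₂ (u₁.inv w) (u₂.inv w) := by
    filter_upwards [he₁, he₂] with w h2 h3
    refine le_trans ?_ (abs_height_sub_le_sheetDist L₁ L₂ (u₁.inv w) (u₂.inv w))
    rw [h2, h3.2, G₁.height_edgeChart, G₂.height_pt j h3.1.le]
    exact (le_abs_self _).trans (abs_sub_comm _ _).le
  -- At most one side of the edge shares the sheet of the second point, by `IsLog.ne_of_fold`. On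
  -- the other side the distance is the sum of the heights, so subtracting or adding the signed
  -- coordinate `Im ζ₁` gives a harmonic function that is exact there and a minorant opposite.
  by_cases hA : G₁.side e = j ∧ L₁ j x = L₂ j (ζ₂ a)
  · have hB : ¬ (G₁.side (G₁.rev e) = j ∧ L₁ j ((G₁.shift e : ℂ) - x) = L₂ j (ζ₂ a)) := by
      rintro ⟨h2, h3⟩
      have h4 := (hL₁ (G₁.side e)).ne_of_fold (h2.trans hA.1.symm) (interior_subset hx)
      rw [hA.1] at h4
      exact h4 (hA.2.trans h3.symm)
    have hne : ∀ᶠ w in 𝓝 a,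
        ¬ (G₁.side (G₁.rev e) = j ∧ L₁ j ((G₁.shift e : ℂ) - ζ₁ w) = L₂ j (ζ₂ w)) := by
      by_cases hj : G₁.side (G₁.rev e) = j
      · have hc₁ : ContinuousAt (fun w => L₁ j ((G₁.shift e : ℂ) - ζ₁ w)) a :=
          (hL₁ j).1.continuousAt.comp (continuousAt_const.sub hζ₁.continuousAt)
        have hc₂ : ContinuousAt (fun w => L₂ j (ζ₂ w)) a :=
          (hL₂ j).1.continuousAt.comp hζ₂.continuousAt
        filter_upwards [(hc₁.sub hc₂).eventually_ne
          (sub_ne_zero.2 (by beta_reduce; rw [hxa]; exact fun h => hB ⟨hj, h⟩))] with w hw h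
        exact hw (sub_eq_zero.2 h.2)
      · exact Eventually.of_forall fun w h => hj h.1
    refine ⟨fun w => -Complex.I * (ζ₂ w - ζ₁ w), analyticAt_const.mul (hζ₂.sub hζ₁), ?_, ?_⟩
    · rw [hval]; simp [hxa]
    · filter_upwards [he₁, he₂, hlow, hne] with w h2 h3 h4 h5
      have hre : (-Complex.I * (ζ₂ w - ζ₁ w)).re = (ζ₂ w).im - (ζ₁ w).im := by simp
      rw [hre]
      rcases le_or_gt 0 (ζ₁ w).im with h6 | h6
      · rwa [abs_of_nonneg h6] at h4
      · have h7 : 0 < ((G₁.shift e : ℂ) - ζ₁ w).im := by simpa using h6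
        rw [G₁.edgeChart_of_neg e h6] at h2
        rw [sheetDist_of_not_same, h2, h3.2, G₁.height_pt _ h7.le, G₂.height_pt _ h3.1.le]
        · simp
        · rw [h2, h3.2, sameSheet_pt_iff h7 h3.1]
          rintro ⟨h8, h9⟩
          exact h5 ⟨h8, h8 ▸ h9⟩
  · have hne : ∀ᶠ w in 𝓝 a, ¬ (G₁.side e = j ∧ L₁ j (ζ₁ w) = L₂ j (ζ₂ w)) := by
      by_cases hj : G₁.side e = j
      · have hc₁ : ContinuousAt (fun w => L₁ j (ζ₁ w)) a :=
          (hL₁ j).1.continuousAt.comp hζ₁.continuousAt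
        have hc₂ : ContinuousAt (fun w => L₂ j (ζ₂ w)) a :=
          (hL₂ j).1.continuousAt.comp hζ₂.continuousAt
        filter_upwards [(hc₁.sub hc₂).eventually_ne
          (sub_ne_zero.2 (by beta_reduce; rw [hxa]; exact fun h => hA ⟨hj, h⟩))] with w hw h
        exact hw (sub_eq_zero.2 h.2)
      · exact Eventually.of_forall fun w h => hj h.1
    refine ⟨fun w => -Complex.I * (ζ₂ w + ζ₁ w), analyticAt_const.mul (hζ₂.add hζ₁), ?_, ?_⟩
    · rw [hval]; simp [hxa]
    · filter_upwards [he₁, he₂, hlow, hne] with w h2 h3 h4 h5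
      have hre : (-Complex.I * (ζ₂ w + ζ₁ w)).re = (ζ₂ w).im + (ζ₁ w).im := by simp
      rw [hre]
      rcases le_or_gt (ζ₁ w).im 0 with h6 | h6
      · rwa [abs_of_nonpos h6, sub_neg_eq_add] at h4
      · rw [G₁.edgeChart_of_nonneg e h6.le] at h2
        rw [sheetDist_of_not_same, h2, h3.2, G₁.height_pt _ h6.le, G₂.height_pt _ h3.1.le, add_comm]
        rw [h2, h3.2, sameSheet_pt_iff h6 h3.1]
        rintro ⟨h8, h9⟩
        exact h5 ⟨h8, h8 ▸ h9⟩

/-- The function `sheetDist` has harmonic local minorants at the points of the open half-planes. -/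
theorem exists_minorant_of_height_pos (hL₁ : ∀ j, u₁.IsLog j (L₁ j))
    (hL₂ : ∀ j, u₂.IsLog j (L₂ j)) {a : ℂ} (h0 : a ≠ 0) (h1 : ‖a‖ < 1)
    (hp : 0 < G₁.height (u₁.inv a)) (hq : 0 < G₂.height (u₂.inv a)) :
    ∃ g : ℂ → ℂ, AnalyticAt ℂ g a ∧ (g a).re = sheetDist L₁ L₂ (u₁.inv a) (u₂.inv a) ∧
      ∀ᶠ w in 𝓝 a, (g w).re ≤ sheetDist L₁ L₂ (u₁.inv w) (u₂.inv w) := by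
  obtain ⟨j, ζ₁, hζ₁, he₁⟩ := u₁.exists_coordinate_of_height_pos h0 h1.le hp
  obtain ⟨i, ζ₂, hζ₂, he₂⟩ := u₂.exists_coordinate_of_height_pos h0 h1.le hq
  have hh₁ : ∀ᶠ w in 𝓝 a, G₁.height (u₁.inv w) = (ζ₁ w).im := he₁.mono fun w hw => by
    rw [hw.2, G₁.height_pt j hw.1.le]
  have hh₂ : ∀ᶠ w in 𝓝 a, G₂.height (u₂.inv w) = (ζ₂ w).im := he₂.mono fun w hw => by
    rw [hw.2, G₂.height_pt i hw.1.le]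
  -- On one sheet the distance dominates both signed height differences, and the one that is
  -- non-negative at `a` touches it; on different sheets the sum of heights is itself harmonic.
  by_cases hs : SameSheet L₁ L₂ (u₁.inv a) (u₂.inv a)
  · have hsub : ∀ z z' : ℂ, (-Complex.I * (z - z')).re = z.im - z'.im := fun z z' => by simp
    rcases le_total (ζ₁ a).im (ζ₂ a).im with h | h
    · refine ⟨fun w => -Complex.I * (ζ₂ w - ζ₁ w), analyticAt_const.mul (hζ₂.sub hζ₁), ?_, ?_⟩
      · rw [sheetDist_of_same hs, hh₁.self_of_nhds, hh₂.self_of_nhds, hsub,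
          abs_of_nonpos (by linarith), neg_sub]
      · filter_upwards [hh₁, hh₂] with w h2 h3
        refine le_trans ?_ (abs_height_sub_le_sheetDist L₁ L₂ (u₁.inv w) (u₂.inv w))
        rw [hsub, h2, h3, abs_sub_comm]
        exact le_abs_self _
    · refine ⟨fun w => -Complex.I * (ζ₁ w - ζ₂ w), analyticAt_const.mul (hζ₁.sub hζ₂), ?_, ?_⟩
      · rw [sheetDist_of_same hs, hh₁.self_of_nhds, hh₂.self_of_nhds, hsub,
          abs_of_nonneg (by linarith)]
      · filter_upwards [hh₁, hh₂] with w h2 h3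
        refine le_trans ?_ (abs_height_sub_le_sheetDist L₁ L₂ (u₁.inv w) (u₂.inv w))
        rw [hsub, h2, h3]
        exact le_abs_self _
  · have hadd : ∀ z z' : ℂ, (-Complex.I * (z + z')).re = z.im + z'.im := fun z z' => by simp
    refine ⟨fun w => -Complex.I * (ζ₁ w + ζ₂ w), analyticAt_const.mul (hζ₁.add hζ₂), ?_, ?_⟩
    · rw [sheetDist_of_not_same hs, hh₁.self_of_nhds, hh₂.self_of_nhds, hadd]
    · filter_upwards [hh₁, hh₂, eventually_sameSheet_iff hL₁ hL₂ h0 h1.le hp hq,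
        isOpen_ne.mem_nhds h0, (isOpen_lt continuous_norm continuous_const).mem_nhds h1]
        with w h2 h3 h4 h5 h6
      rw [hadd, sheetDist_of_not_same fun h7 => hs ((h4 h5 (le_of_lt h6)).1 h7), h2, h3]

theorem exists_minorant (hL₁ : ∀ j, u₁.IsLog j (L₁ j)) (hL₂ : ∀ j, u₂.IsLog j (L₂ j)) {a : ℂ}
    (h0 : a ≠ 0) (h1 : ‖a‖ < 1) (hV : a ∉ u₁.vertices ∪ u₂.vertices)
    (hpos : 0 < sheetDist L₁ L₂ (u₁.inv a) (u₂.inv a)) :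
    ∃ g : ℂ → ℂ, AnalyticAt ℂ g a ∧ (g a).re = sheetDist L₁ L₂ (u₁.inv a) (u₂.inv a) ∧
      ∀ᶠ w in 𝓝 a, (g w).re ≤ sheetDist L₁ L₂ (u₁.inv w) (u₂.inv w) := by
  rw [Set.mem_union, not_or] at hV
  rcases u₁.inv_cases h0 h1 hV.1 with ⟨j, z, hz, h2⟩ | ⟨e, x, hx, h2⟩ <;>
    rcases u₂.inv_cases h0 h1 hV.2 with ⟨i, z', hz', h3⟩ | ⟨f, y, hy, h3⟩
  · exact exists_minorant_of_height_pos hL₁ hL₂ h0 h1 (by rwa [h2, G₁.height_pt j hz.le])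
      (by rwa [h3, G₂.height_pt i hz'.le])
  · simp only [sheetDist_comm L₁ L₂]
    exact exists_minorant_of_edge hL₂ hL₁ h0 h1.le hy h3 (by rwa [h2, G₁.height_pt j hz.le])
  · exact exists_minorant_of_edge hL₁ hL₂ h0 h1.le hx h2 (by rwa [h3, G₂.height_pt i hz'.le])
  · have := sheetDist_le L₁ L₂ (u₁.inv a) (u₂.inv a)
    rw [h2, h3, G₁.height_edgeChart, G₂.height_edgeChart, ← h2, ← h3] at this
    simp only [Complex.ofReal_im, abs_zero, add_zero] at this
    exact absurd hpos (not_lt.2 this)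

/-! ### Comparison of two model maps at bounded distance. -/

/-- If the model maps are at bounded distance, then the logarithms can be chosen such that points
of large height lie on the same sheet. -/
theorem exists_isLog_sameSheet [NeZero k] (hL₁ : ∀ j, u₁.IsLog j (L₁ j)) {C : ℝ} (hC0 : 0 ≤ C)
    (hC : ∀ w : ℂ, w ≠ 0 → ‖w‖ < 1 → dist (G₁.collapse (u₁.inv w)) (G₂.collapse (u₂.inv w)) ≤ C) :
    ∃ L₂ : ZMod k → ℂ → ℂ, (∀ j, u₂.IsLog j (L₂ j)) ∧ ∀ w : ℂ, w ≠ 0 → ‖w‖ < 1 →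
      C + 1 ≤ G₁.height (u₁.inv w) → SameSheet L₁ L₂ (u₁.inv w) (u₂.inv w) := by
  have key : ∀ j, ∃ M, u₂.IsLog j M ∧ ∀ z : ℂ, C + 1 ≤ z.im → ∃ z' : ℂ, 0 < z'.im ∧
      u₂.inv (u₁.φ (G₁.pt j (toHalfPlane z))) = G₂.pt j (toHalfPlane z') ∧ L₁ j z = M z' := by
    intro j
    set T : Set ℂ := {z | C + 1 ≤ z.im} with hT
    have hTc : IsPreconnected T := (convex_halfSpace_im_ge (C + 1)).isPreconnected
    set W : ℂ → ℂ := fun z => (u₁.φ (G₁.pt j (toHalfPlane z)) : ℂ) with hW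
    -- From height at least `C + 1`, another prong is at distance at least `C + 1`, and height zero
    -- on the same prong as well.
    have hex : ∀ z ∈ T, ∃ z' : ℂ, 0 < z'.im ∧ u₂.inv (W z) = G₂.pt j (toHalfPlane z') := by
      intro z hz
      have hz : C + 1 ≤ z.im := hz
      have hz0 : 0 < z.im := by linarith
      obtain ⟨i, z', hz', hq⟩ := G₂.exists_pt (u₂.inv (W z))
      have h1 := hC (W z) (u₁.φ _).2.1 (u₁.norm_lt_one (by rwa [G₁.height_pt j hz0.le]))
      rw [hq, u₁.inv_φ, G₁.collapse_pt j hz0.le, G₂.collapse_pt i hz'] at h1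
      by_cases hij : j = i
      · subst hij
        rw [dist_prong_same] at h1
        exact ⟨z', by linarith [le_abs_self (z.im - z'.im)], hq⟩
      · rw [dist_prong_ne _ _ hij] at h1
        linarith
    choose! b hb hbq using hex
    obtain ⟨M, hM⟩ := u₂.exists_isLog j
    have hexp : ∀ z ∈ T, Complex.exp (L₁ j z - M (b z)) = 1 := by
      intro z hz
      rw [Complex.exp_sub, (hL₁ j).2, hM.2, ← hbq z hz, u₂.φ_inv (u₁.φ _).2.1 (u₁.φ _).2.2]
      exact div_self (u₁.φ _).2.1
    have hcont : ContinuousOn (fun z => L₁ j z - M (b z)) T := by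
      refine (hL₁ j).1.continuousOn.sub fun z hz => hM.1.continuousAt.comp_continuousWithinAt ?_
      obtain ⟨i, ζ, hζ, he⟩ := u₂.exists_coordinate_of_height_pos (a := W z) (u₁.φ _).2.1
        (u₁.φ _).2.2 (by rw [hbq z hz, G₂.height_pt j (hb z hz).le]; exact hb z hz)
      have hWc : Continuous W := u₁.continuous_φ_pt j
      have hbe : ∀ᶠ y in 𝓝 z, y ∈ T → b y = ζ (W y) := by
        filter_upwards [hWc.continuousAt.eventually he] with y h2 h3
        have h4 := h2.2
        rw [hbq y h3] at h4
        exact ((G₂.pt_eq_of_im_pos (hb y h3) h2.1.le h4).2).symm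
      have h5 : ContinuousAt (fun y => ζ (W y)) z :=
        ContinuousAt.comp (f := W) (g := ζ) hζ.continuousAt hWc.continuousAt
      refine h5.continuousWithinAt.congr_of_eventuallyEq ?_ (hbe.self_of_nhds hz)
      filter_upwards [nhdsWithin_le_nhds hbe, self_mem_nhdsWithin] with y h6 h7 using h6 h7
    set o : ℂ := ((C + 1 : ℝ) : ℂ) * Complex.I with ho
    have hoT : o ∈ T := by
      change C + 1 ≤ o.im
      rw [ho, Complex.im_ofReal_mul, Complex.I_im, mul_one]
    -- On the connected set `T` the two logarithms differ by a constant period, so the period found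
    -- at the base point `o` corrects `M` everywhere on `T`.
    refine ⟨_, hM.add (hexp o hoT), fun z hz => ⟨b z, hb z hz, hbq z hz, ?_⟩⟩
    have := eq_of_exp_eq_one hTc hcont hexp hz hoT
    linear_combination this
  choose L₂ hL₂ hs using key
  refine ⟨L₂, hL₂, fun w h0 h1 hw => ?_⟩
  obtain ⟨j, z, hz, hp⟩ := G₁.exists_pt (u₁.inv w)
  rw [hp, G₁.height_pt j hz] at hw
  obtain ⟨z', hz', hq, h2⟩ := hs j z hw
  rw [← hp, u₁.φ_inv h0 h1.le] at hq
  exact ⟨j, z, z', by linarith, hz', hp, hq, h2⟩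

/-- Two planar ends with collapsing maps at bounded distance have the same collapsing map. -/
theorem collapse_eq_of_bounded [NeZero k] (u₁ : Uniformization G₁ θ₁) (u₂ : Uniformization G₂ θ₂)
    {C : ℝ} (hC0 : 0 ≤ C)
    (hC : ∀ w : ℂ, w ≠ 0 → ‖w‖ < 1 → dist (G₁.collapse (u₁.inv w)) (G₂.collapse (u₂.inv w)) ≤ C)
    {w : ℂ} (h0 : w ≠ 0) (h1 : ‖w‖ ≤ 1) : G₁.collapse (u₁.inv w) = G₂.collapse (u₂.inv w) := by
  choose L₁ hL₁ using u₁.exists_isLog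
  obtain ⟨L₂, hL₂, hs⟩ := exists_isLog_sameSheet hL₁ hC0 hC
  have hbd : ∀ w : ℂ, ‖w‖ = 1 → sheetDist L₁ L₂ (u₁.inv w) (u₂.inv w) ≤ 0 := by
    intro w hw
    refine (sheetDist_le _ _ _ _).trans ?_
    rw [u₁.height_inv_of_norm_eq_one hw, u₂.height_inv_of_norm_eq_one hw, add_zero]
  -- On different sheets the first height is below `C + 1`, and the second exceeds it by at most
  -- `C`; the sum is below `3 * C + 2`.
  have hB : ∀ w : ℂ, w ≠ 0 → ‖w‖ ≤ 1 → sheetDist L₁ L₂ (u₁.inv w) (u₂.inv w) ≤ 3 * C + 2 := by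
    intro w h0 h1
    rcases h1.lt_or_eq with h1 | h1
    · have h2 := (abs_height_sub_le_dist_collapse (u₁.inv w) (u₂.inv w)).trans (hC w h0 h1)
      by_cases h3 : SameSheet L₁ L₂ (u₁.inv w) (u₂.inv w)
      · rw [sheetDist_of_same h3]; linarith
      · have h4 : G₁.height (u₁.inv w) < C + 1 := not_le.1 fun h4 => h3 (hs w h0 h1 h4)
        rw [sheetDist_of_not_same h3]
        linarith [(abs_le.1 h2).1]
    · linarith [hbd w h1]
  have h2 := nonpos_of_harmonic_minorants (fun w => sheetDist L₁ L₂ (u₁.inv w) (u₂.inv w))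
    (continuousOn_sheetDist hL₁ hL₂) (3 * C + 2) hB hbd (u₁.vertices ∪ u₂.vertices)
    (u₁.finite_vertices.union u₂.finite_vertices)
    (fun a ha0 ha1 haV hpos => exists_minorant hL₁ hL₂ ha0 ha1 haV hpos) w h0 h1
  exact dist_le_zero.1 ((dist_collapse_le_sheetDist L₁ L₂ _ _).trans h2)

end Uniformization

end

theorem lemma3 (k : ℕ) [NeZero k] (m₁ m₂ : PuncturedDisk → ProngedTree k)
    (h₁ : m₁ ∈ modelMaps k) (h₂ : m₂ ∈ modelMaps k) (hne : m₁ ≠ m₂) :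
    ∀ C : ℝ, ∃ z : PuncturedDisk, C < dist (m₁ z) (m₂ z) := by
  intro C
  by_contra! hC
  obtain ⟨G₁, θ₁, u₁, rfl⟩ := h₁
  obtain ⟨G₂, θ₂, u₂, rfl⟩ := h₂
  have hm₁ : ∀ w : PuncturedDisk, modelMap u₁ w = G₁.collapse (u₁.inv w) := fun w => by
    rw [u₁.inv_eq ⟨w, w.2.1, w.2.2.le⟩]; rfl
  have hm₂ : ∀ w : PuncturedDisk, modelMap u₂ w = G₂.collapse (u₂.inv w) := fun w => by
    rw [u₂.inv_eq ⟨w, w.2.1, w.2.2.le⟩]; rfl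
  have hC0 : 0 ≤ C := dist_nonneg.trans (hC ⟨1 / 2, by norm_num, by norm_num⟩)
  refine hne (funext fun w => ?_)
  rw [hm₁, hm₂]
  refine Uniformization.collapse_eq_of_bounded u₁ u₂ hC0 (fun v hv0 hv1 => ?_) w.2.1 w.2.2.le
  have := hC ⟨v, hv0, hv1⟩
  rwa [hm₁, hm₂] at this
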